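/- Let $\mathbb K$ be a field, $t\in\mathbb K$, and $G$ a finite group. \textbf{Knop's construction.} Let $\mathcal A$ be a category with finite limits, in which every morphism has an image, every morphism that is both mono and epi is invertible, and epimorphisms are stable under pullback. A \emph{degree function} $\delta$ on $\mathcal A$ assigns a scalar $\delta(e)\in\mathbb K$ to each epimorphism $e$, such that $\delta(\mathrm{id})=1$, $\delta(e'e)=\delta(e')\delta(e)$, and $\delta(e')=\delta(e)$ whenever $e'$ is a pullback of $e$. The category $\mathcal T^0(\mathcal A,\delta)$ has one object $[x]$ for each object $x$ of $\mathcal A$; its morphisms $[x]\to[y]$ are the formal $\mathbb K$-linear combinations of relations, i.e. of subobjects $r\subset x\times y$, the basis element given by $r$ being written $\langle r\rangle$; and for $r\subset x\times y$, $s\subset y\times z$ one sets $\langle s\rangle\circ\langle r\rangle=\delta(e)\langle \mathrm{im}(r\times_y s\to x\times z)\rangle$, where $e$ is the epimorphism of $r\times_y s$ onto this image. $\mathcal T(\mathcal A,\delta)$ is the additive Karoubi completion of $\mathcal T^0(\mathcal A,\delta)$; it is a $\mathbb K$-linear symmetric monoidal category with $[x]\otimes[y]=[x\times y]$ and unit $[\mathbf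 1]$, where $\mathbf 1$ is the terminal object. The functor $\Gamma:\mathcal A\to\mathcal T(\mathcal A,\delta)$ sends $x$ to $[x]$ and $f:x\to y$ to $\langle \text{graph of } f\rangle$. \textbf{The two categories.} Let $\mathbf{Sets}$ and $G\text{-}\mathbf{Sets}$ be the categories of finite sets and of finite $G$-sets. On $\mathbf{Sets}^{op}$ let $\delta_t(e)=t^{|Y\setminus e(X)|}$ for an injective map $e:X\to Y$ (an epimorphism of $\mathbf{Sets}^{op}$). For a function $\phi$ from the set of isomorphism classes of nonempty transitive finite $G$-sets to $\mathbb K$, let $\delta_\phi$ be the degree function on $G\text{-}\mathbf{Sets}^{op}$ with $\delta_\phi(e)=\prod_S\phi(S)$ for an injective $G$-map $e:X\to Y$, where $S$ runs over the $G$-orbits in $Y\setminus e(X)$; let $\phi_t$ be the constant function with value $t$. Put $\underline{\mathrm{Rep}}(S_t)=\mathcal T(\mathbf{Sets}^{op},\delta_t)$. Let $T:\mathbf{Sets}^{op}\to G\text{-}\mathbf{Sets}^{op}$ be the functor endowing a set with the trivial action and $F:G\text{-}\mathbf{Sets}^{op}\to\mathbf{Sets}^{op}$ the functor $X\mapsto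 X/G$ of orbits; $T$ is left adjoint to $F$, and $\eta:\mathrm{Id}_{\mathbf{Sets}^{op}}\to FT$ denotes the unit of this adjunction. \textbf{Induced functors.} Let $H:\mathcal A\to\mathcal A'$ be a functor, and $\delta,\delta'$ degree functions on $\mathcal A,\mathcal A'$. A functor \emph{induced by} $H$ is a $\mathbb K$-linear symmetric monoidal functor $\overline H:\mathcal T(\mathcal A,\delta)\to\mathcal T(\mathcal A',\delta')$ together with isomorphisms $\overline H([x])\cong[Hx]$ for all $x$, under which $\overline H\langle r\rangle$ becomes $\langle Hr\rangle$ for every relation $r\subset x\times y$, where $Hr$ is the image of $H(r)\to H(x)\times H(y)$, and under which the monoidal structure morphisms of $\overline H$ correspond, through $\Gamma$, to the canonical morphisms $H(x\times y)\to H(x)\times H(y)$ and $H(\mathbf 1)\to\mathbf 1$. \textbf{Lemma.} \begin{enumerate} \item $T$ and $F$ preserve pullbacks and terminal objects. \item $T$ and $F$ preserve the degree functions: they map epimorphisms to epimorphisms, $\delta_{\phi_t}(T(e))=\delta_t(e)$ for every epimorphism $e$ of $\mathbf{Sets}^{op}$, and $\delta_t(F(e))=\delta_{\phi_t}(e)$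 for every epimorphism $e$ of $G\text{-}\mathbf{Sets}^{op}$. \item There are induced $\mathbb K$-linear symmetric monoidal functors $\overline T:\underline{\mathrm{Rep}}(S_t)\to\mathcal T(G\text{-}\mathbf{Sets}^{op},\delta_{\phi_t})$ and $\overline F:\mathcal T(G\text{-}\mathbf{Sets}^{op},\delta_{\phi_t})\to\underline{\mathrm{Rep}}(S_t)$. \item For all induced functors $\overline T$ and $\overline F$ as in (3), $\Gamma(\eta)$ is an isomorphism $\mathrm{Id}\cong\overline F\,\overline T$: there is a natural isomorphism $\alpha:\mathrm{Id}\to\overline F\,\overline T$ whose component at $[x]$, composed with the isomorphisms $\overline F\,\overline T([x])\cong\overline F([Tx])\cong[FTx]$, is $\Gamma(\eta_x):[x]\to[FTx]$, for every finite set $x$. \end{enumerate} -/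

import Mathlib

open CategoryTheory Limits MonoidalCategory

universe u v w u' v'

noncomputable section

namespace Knop

/-- Regular categories: there are finite limits and images, and epimorphisms are preserved under
pullbacks. In this presentation all finite limits are required to exist, and a monomorphism that is
an epimorphism is required to be invertible, so that the product of two relations is always
defined. -/
class RegularCat (A : Type u) [Category.{v} A] : Prop where
  finLim : HasFiniteLimits A
  images : HasImages A
  balanced : Balanced A
  epi_snd : ∀ {x y z : A} (f : x ⟶ z) (g : y ⟶ z) [Epi f], Epi (pullback.snd f g)

attribute [instance] RegularCat.finLim RegularCat.images RegularCat.balanced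

/-- Degree functions: multiplicative functions on the epimorphisms, with values in a field, that are
preserved under pullbacks. -/
structure DegreeFunction (A : Type u) [Category.{v} A] (K : Type w) [Field K] where
  deg : ∀ {x y : A} (e : x ⟶ y) [Epi e], K
  deg_id : ∀ x : A, deg (𝟙 x) = 1
  deg_comp : ∀ {x y z : A} (e : x ⟶ y) (e' : y ⟶ z) [Epi e] [Epi e'],
    deg (e ≫ e') = deg e' * deg e
  deg_pullback : ∀ {p x y z : A} {fst : p ⟶ x} {snd : p ⟶ y} {f : x ⟶ z} {g : y ⟶ z},
    IsPullback fst snd f g → ∀ [Epi f] [Epi snd], deg snd = deg f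

section Construction

attribute [local simp] prod.lift_fst prod.lift_snd prod.lift_fst_assoc prod.lift_snd_assoc
  pullback.lift_fst pullback.lift_snd pullback.lift_fst_assoc pullback.lift_snd_assoc

variable {A : Type u} [Category.{v} A] {K : Type w} [Field K]

theorem DegreeFunction.deg_iso (δ : DegreeFunction A K) {x y : A} (e : x ⟶ y) [IsIso e] :
    δ.deg e = 1 := by
  rw [δ.deg_pullback (IsPullback.of_vert_isIso (⟨by simp⟩ : CommSq e e (𝟙 y) (𝟙 y))), δ.deg_id]

theorem DegreeFunction.deg_congr (δ : DegreeFunction A K) {x y : A} {e e' : x ⟶ y} [Epi e] [Epi e']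
    (h : e = e') : δ.deg e = δ.deg e' := by subst h; rfl

variable [RegularCat A]

theorem epi_of_isPullback {p x y z : A} {fst : p ⟶ x} {snd : p ⟶ y} {f : x ⟶ z} {g : y ⟶ z}
    (h : IsPullback fst snd f g) [Epi f] : Epi snd := by
  have := RegularCat.epi_snd f g
  rw [← h.isoPullback_hom_snd]
  infer_instance

/-- A relation between `x` and `y` is a subobject of `x ⨯ y`. -/
abbrev Rel (x y : A) : Type max u v := Subobject (x ⨯ y)

variable (K) in
/-- The formal linear combinations of relations. -/
abbrev LRel (x y : A) : Type max u v w := Rel x y →₀ K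

/-- The first leg of a relation. -/
def Rel.p {x y : A} (r : Rel x y) : (r : A) ⟶ x := r.arrow ≫ prod.fst

/-- The second leg of a relation. -/
def Rel.q {x y : A} (r : Rel x y) : (r : A) ⟶ y := r.arrow ≫ prod.snd

/-- The image in `x ⨯ y` of a span `x ⟵ a ⟶ y`, weighted by the degree of the projection of `a` onto
that image. -/
def spanRel (δ : DegreeFunction A K) {a x y : A} (f : a ⟶ x) (g : a ⟶ y) : LRel K x y :=
  Finsupp.single (imageSubobject (prod.lift f g))
    (δ.deg (factorThruImageSubobject (prod.lift f g)))

variable (δ : DegreeFunction A K)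

theorem Rel.lift_p_q {x y : A} (r : Rel x y) : prod.lift r.p r.q = r.arrow := by
  ext <;> simp [Rel.p, Rel.q]

theorem spanRel_of_fac {a x y : A} (f : a ⟶ x) (g : a ⟶ y) (r : Rel x y) (e : a ⟶ (r : A)) [Epi e]
    (hf : e ≫ r.p = f) (hg : e ≫ r.q = g) :
    spanRel δ f g = Finsupp.single r (δ.deg e) := by
  have hl : e ≫ r.arrow = prod.lift f g := by
    rw [← hf, ← hg, ← r.lift_p_q, prod.comp_lift]
  have hle : imageSubobject (prod.lift f g) ≤ r := imageSubobject_le _ e hl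
  have hm : factorThruImageSubobject (prod.lift f g) ≫ Subobject.ofLE _ _ hle = e := by
    rw [← cancel_mono r.arrow, Category.assoc, Subobject.ofLE_arrow, imageSubobject_arrow_comp, hl]
  have : Epi (Subobject.ofLE _ _ hle) := by
    have : Epi (factorThruImageSubobject (prod.lift f g) ≫ Subobject.ofLE _ _ hle) := by
      rw [hm]; infer_instance
    exact epi_of_epi (factorThruImageSubobject (prod.lift f g)) _
  have : IsIso (Subobject.ofLE _ _ hle) := isIso_of_mono_of_epi _
  have hr : imageSubobject (prod.lift f g) = r := by
    refine le_antisymm hle ?_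
    exact Subobject.le_of_comm (inv (Subobject.ofLE _ _ hle)) (by simp)
  have hd : δ.deg (factorThruImageSubobject (prod.lift f g)) = δ.deg e := by
    rw [← δ.deg_congr hm, δ.deg_comp, δ.deg_iso (Subobject.ofLE _ _ hle), one_mul]
  rw [spanRel, hd, hr]

theorem spanRel_rel {x y : A} (r : Rel x y) :
    spanRel δ r.p r.q = Finsupp.single r 1 := by
  rw [spanRel_of_fac δ _ _ r (𝟙 _) (by simp) (by simp), δ.deg_id]

theorem spanRel_mk {a x y : A} (f : a ⟶ x) (g : a ⟶ y) [Mono (prod.lift f g)] :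
    spanRel δ f g = Finsupp.single (Subobject.mk (prod.lift f g)) 1 := by
  rw [spanRel_of_fac δ f g (Subobject.mk (prod.lift f g))
    (Subobject.underlyingIso (prod.lift f g)).inv (by simp [Rel.p]) (by simp [Rel.q]), δ.deg_iso]

theorem spanRel_comp {a b x y : A} (e : b ⟶ a) [Epi e] (f : a ⟶ x) (g : a ⟶ y) :
    spanRel δ (e ≫ f) (e ≫ g) = δ.deg e • spanRel δ f g := by
  rw [spanRel_of_fac δ (e ≫ f) (e ≫ g) (imageSubobject (prod.lift f g))
    (e ≫ factorThruImageSubobject (prod.lift f g)) (by simp [Rel.p]) (by simp [Rel.q]), spanRel,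
    δ.deg_comp, Finsupp.smul_single, smul_eq_mul, mul_comm]

theorem spanRel_iso {a b x y : A} (e : b ⟶ a) [IsIso e] (f : a ⟶ x) (g : a ⟶ y) :
    spanRel δ (e ≫ f) (e ≫ g) = spanRel δ f g := by
  rw [spanRel_comp, δ.deg_iso, one_smul]

theorem spanRel_eq_smul {a x y : A} (f : a ⟶ x) (g : a ⟶ y) :
    ∃ (r : Rel x y) (e : a ⟶ (r : A)) (_ : Epi e), e ≫ r.p = f ∧ e ≫ r.q = g :=
  ⟨imageSubobject (prod.lift f g), factorThruImageSubobject (prod.lift f g), inferInstance,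
    by simp [Rel.p], by simp [Rel.q]⟩

/-- The composite of two relations: the image of `r ×_y s` in `x ⨯ z`, weighted by the degree of the
projection of `r ×_y s` onto it. -/
def compRel {x y z : A} (r : Rel x y) (s : Rel y z) : LRel K x z :=
  spanRel δ (pullback.fst r.q s.p ≫ r.p) (pullback.snd r.q s.p ≫ s.q)

/-- The bilinear extension of `compRel`. -/
def comp (x y z : A) : LRel K x y →ₗ[K] LRel K y z →ₗ[K] LRel K x z :=
  Finsupp.linearCombination K fun r => Finsupp.linearCombination K fun s => compRel δ r s

theorem comp_single {x y z : A} (r : Rel x y) (s : Rel y z) (a b : K) :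
    comp δ x y z (Finsupp.single r a) (Finsupp.single s b) = (a * b) • compRel δ r s := by
  simp [comp, mul_smul]

theorem comp_add_left {x y z : A} (f g : LRel K x y) (h : LRel K y z) :
    comp δ x y z (f + g) h = comp δ x y z f h + comp δ x y z g h := by
  rw [map_add, LinearMap.add_apply]

theorem comp_add_right {x y z : A} (f : LRel K x y) (g h : LRel K y z) :
    comp δ x y z f (g + h) = comp δ x y z f g + comp δ x y z f h := map_add _ _ _

theorem comp_smul_left {x y z : A} (c : K) (f : LRel K x y) (h : LRel K y z) :
    comp δ x y z (c • f) h = c • comp δ x y z f h := by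
  rw [map_smul, LinearMap.smul_apply]

theorem comp_smul_right {x y z : A} (c : K) (f : LRel K x y) (h : LRel K y z) :
    comp δ x y z f (c • h) = c • comp δ x y z f h := map_smul _ _ _

theorem deg_pullback_map {a b c r s y : A} (e : a ⟶ r) (e' : b ⟶ s) [Epi e] [Epi e']
    (g : r ⟶ y) (h : s ⟶ y) {p : c ⟶ a} {q : c ⟶ b} (sq : IsPullback p q (e ≫ g) (e' ≫ h)) :
    ∃ (m : c ⟶ pullback g h) (_ : Epi m), m ≫ pullback.fst g h = p ≫ e ∧
      m ≫ pullback.snd g h = q ≫ e' ∧ δ.deg m = δ.deg e * δ.deg e' := by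
  let m₁ : c ⟶ pullback g (e' ≫ h) := pullback.lift (p ≫ e) q (by simpa using sq.w)
  let m₂ : pullback g (e' ≫ h) ⟶ pullback g h :=
    pullback.lift (pullback.fst _ _) (pullback.snd _ _ ≫ e') (by simp [pullback.condition])
  have s₁ : IsPullback p m₁ e (pullback.fst g (e' ≫ h)) := by
    refine (IsPullback.of_right (h₁₂ := pullback.snd g (e' ≫ h)) (h₂₂ := g) (v₁₃ := e' ≫ h)
      ?_ (by simp [m₁]) (IsPullback.of_hasPullback g (e' ≫ h)).flip).flip
    simpa [m₁] using sq.flip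
  have s₂ : IsPullback (pullback.snd g (e' ≫ h)) m₂ e' (pullback.snd g h) := by
    refine (IsPullback.of_right (h₁₂ := pullback.fst g h) (h₂₂ := h) (v₁₃ := g)
      ?_ (by simp [m₂]) (IsPullback.of_hasPullback g h)).flip
    simpa [m₂] using IsPullback.of_hasPullback g (e' ≫ h)
  have := epi_of_isPullback s₁
  have := epi_of_isPullback s₂
  refine ⟨m₁ ≫ m₂, inferInstance, by simp [m₁, m₂], by simp [m₁, m₂], ?_⟩
  rw [δ.deg_comp, δ.deg_pullback s₁, δ.deg_pullback s₂, mul_comm]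

theorem comp_span {a b c x y z : A} {f : a ⟶ x} {g : a ⟶ y} {h : b ⟶ y} {k : b ⟶ z}
    {p : c ⟶ a} {q : c ⟶ b} (sq : IsPullback p q g h) :
    comp δ x y z (spanRel δ f g) (spanRel δ h k) = spanRel δ (p ≫ f) (q ≫ k) := by
  obtain ⟨r, e, _, rfl, rfl⟩ := spanRel_eq_smul f g
  obtain ⟨s, e', _, rfl, rfl⟩ := spanRel_eq_smul h k
  obtain ⟨m, _, h₁, h₂, hm⟩ := deg_pullback_map δ e e' r.q s.p sq
  rw [spanRel_comp, spanRel_comp, spanRel_rel, spanRel_rel, map_smul, map_smul,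
    LinearMap.smul_apply, comp_single, one_mul, one_smul, compRel, smul_smul, ← Category.assoc,
    ← Category.assoc, ← h₁, ← h₂, Category.assoc, Category.assoc, spanRel_comp, hm]
  rw [mul_comm]

theorem span_ind {x y : A} {P : LRel K x y → Prop} (f : LRel K x y)
    (zero : P 0) (add : ∀ f g, P f → P g → P (f + g)) (smul : ∀ (c : K) f, P f → P (c • f))
    (span : ∀ {a : A} (f : a ⟶ x) (g : a ⟶ y), P (spanRel δ f g)) : P f := by
  induction f using Finsupp.induction_linear with
  | zero => exact zero
  | add f g hf hg => exact add f g hf hg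
  | single r c => simpa [spanRel_rel] using smul c _ (span r.p r.q)

variable (K) in
/-- The graph of a morphism, as a relation. -/
def graph {x y : A} (f : x ⟶ y) : LRel K x y :=
  Finsupp.single (Subobject.mk (prod.lift (𝟙 x) f)) 1

theorem graph_eq {x y : A} (f : x ⟶ y) : graph K f = spanRel δ (𝟙 x) f :=
  (spanRel_mk δ _ _).symm

theorem span_comp_graph {a x y z : A} (f : a ⟶ x) (g : a ⟶ y) (h : y ⟶ z) :
    comp δ x y z (spanRel δ f g) (graph K h) = spanRel δ f (g ≫ h) := by
  rw [graph_eq δ, comp_span δ (IsPullback.of_vert_isIso (⟨by simp⟩ : CommSq g (𝟙 a) (𝟙 y) g)).flip]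
  simp

theorem graph_comp_span {a b x y z : A} {h : x ⟶ y} {f : a ⟶ y} {g : a ⟶ z} {p : b ⟶ x}
    {q : b ⟶ a} (sq : IsPullback p q h f) :
    comp δ x y z (graph K h) (spanRel δ f g) = spanRel δ p (q ≫ g) := by
  rw [graph_eq δ, comp_span δ sq, Category.comp_id]

theorem iso_comp_span {a x y z : A} (h : x ⟶ y) [IsIso h] (f : a ⟶ y) (g : a ⟶ z) :
    comp δ x y z (graph K h) (spanRel δ f g) = spanRel δ (f ≫ inv h) g := by
  rw [graph_comp_span δ (p := f ≫ inv h) (q := 𝟙 a) (IsPullback.of_horiz_isIso ⟨by simp⟩).flip,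
    Category.id_comp]

theorem graph_comp_graph {x y z : A} (f : x ⟶ y) (g : y ⟶ z) :
    comp δ x y z (graph K f) (graph K g) = graph K (f ≫ g) := by
  rw [graph_eq δ f, span_comp_graph, graph_eq δ]

theorem id_comp' {x y : A} (f : LRel K x y) : comp δ x x y (graph K (𝟙 x)) f = f := by
  induction f using span_ind δ with
  | zero => simp
  | add f g hf hg => rw [map_add, hf, hg]
  | smul c f hf => rw [map_smul, hf]
  | span f g => simp [iso_comp_span]

theorem comp_id' {x y : A} (f : LRel K x y) : comp δ x y y f (graph K (𝟙 y)) = f := by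
  induction f using span_ind δ with
  | zero => simp
  | add f g hf hg => rw [map_add, LinearMap.add_apply, hf, hg]
  | smul c f hf => rw [map_smul, LinearMap.smul_apply, hf]
  | span f g => simp [span_comp_graph]

theorem assoc' {x y z t : A} (f : LRel K x y) (g : LRel K y z) (h : LRel K z t) :
    comp δ x z t (comp δ x y z f g) h = comp δ x y t f (comp δ y z t g h) := by
  induction f using span_ind δ with
  | zero => simp
  | add f g hf hg => simp only [map_add, LinearMap.add_apply, hf, hg]
  | smul c f hf => simp only [map_smul, LinearMap.smul_apply, hf]
  | span f₁ f₂ =>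
  induction g using span_ind δ with
  | zero => simp
  | add f g hf hg => simp only [map_add, LinearMap.add_apply, hf, hg]
  | smul c f hf => simp only [map_smul, LinearMap.smul_apply, hf]
  | span g₁ g₂ =>
  induction h using span_ind δ with
  | zero => simp
  | add f g hf hg => simp only [map_add, hf, hg]
  | smul c f hf => simp only [map_smul, hf]
  | span h₁ h₂ =>
  have s₁ := IsPullback.of_hasPullback f₂ g₁
  have s₂ := IsPullback.of_hasPullback g₂ h₁
  have s₃ := IsPullback.of_hasPullback (pullback.snd f₂ g₁) (pullback.fst g₂ h₁)
  rw [comp_span δ s₁, comp_span δ s₂, comp_span δ (s₃.paste_vert s₂), comp_span δ (s₃.paste_horiz s₁)]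
  simp

/-! ### Tensor product of relations -/

theorem Rel.hom_ext {c x y : A} (r : Rel x y) {f g : c ⟶ (r : A)} (h : f ≫ r.p = g ≫ r.p)
    (h' : f ≫ r.q = g ≫ r.q) : f = g := by
  rw [← cancel_mono r.arrow, ← r.lift_p_q, prod.comp_lift, prod.comp_lift, h, h']

instance {x y x' y' : A} (r : Rel x y) (r' : Rel x' y') :
    Mono (prod.lift (prod.map r.p r'.p) (prod.map r.q r'.q)) := by
  refine ⟨fun {c} f g h => ?_⟩
  have h₁ := h =≫ prod.fst
  have h₂ := h =≫ prod.snd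
  simp only [Category.assoc, prod.lift_fst, prod.lift_snd] at h₁ h₂
  apply prod.hom_ext
  · exact r.hom_ext (by simpa using h₁ =≫ prod.fst) (by simpa using h₂ =≫ prod.fst)
  · exact r'.hom_ext (by simpa using h₁ =≫ prod.snd) (by simpa using h₂ =≫ prod.snd)

/-- The product of two relations, as a relation between the products. -/
def Rel.prod {x y x' y' : A} (r : Rel x y) (r' : Rel x' y') : Rel (x ⨯ x') (y ⨯ y') :=
  Subobject.mk (prod.lift (prod.map r.p r'.p) (prod.map r.q r'.q))

variable (K) in
/-- The bilinear extension of the product of relations. -/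
def tensor (x y x' y' : A) :
    LRel K x y →ₗ[K] LRel K x' y' →ₗ[K] LRel K (x ⨯ x') (y ⨯ y') :=
  Finsupp.linearCombination K fun r => Finsupp.linearCombination K fun r' =>
    Finsupp.single (r.prod r') 1

theorem isPullback_map {a b c y a' b' c' y' : A} {p : c ⟶ a} {q : c ⟶ b} {g : a ⟶ y} {h : b ⟶ y}
    {p' : c' ⟶ a'} {q' : c' ⟶ b'} {g' : a' ⟶ y'} {h' : b' ⟶ y'} (s : IsPullback p q g h)
    (s' : IsPullback p' q' g' h') :
    IsPullback (prod.map p p') (prod.map q q') (prod.map g g') (prod.map h h') := by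
  refine ⟨⟨by simp [s.w, s'.w]⟩, ⟨PullbackCone.IsLimit.mk _
    (fun t => prod.lift
      (s.lift (t.fst ≫ prod.fst) (t.snd ≫ prod.fst) ?_)
      (s'.lift (t.fst ≫ prod.snd) (t.snd ≫ prod.snd) ?_)) ?_ ?_ ?_⟩⟩
  · simpa using t.condition =≫ prod.fst
  · simpa using t.condition =≫ prod.snd
  · intro t; ext <;> simp
  · intro t; ext <;> simp
  · intro t m h₁ h₂
    ext
    · apply s.hom_ext
      · simp [← h₁]
      · simp [← h₂]
    · apply s'.hom_ext
      · simp [← h₁]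
      · simp [← h₂]

theorem isPullback_fst_map {a b : A} (e : a ⟶ b) (c : A) :
    IsPullback prod.fst (prod.map e (𝟙 c)) e prod.fst := by
  refine ⟨⟨by simp⟩, ⟨PullbackCone.IsLimit.mk _
    (fun t => prod.lift t.fst (t.snd ≫ prod.snd)) ?_ ?_ ?_⟩⟩
  · intro t; simp
  · intro t; ext <;> simp [t.condition]
  · intro t m h₁ h₂; ext <;> simp [← h₁, ← h₂]

theorem isPullback_snd_map {a b : A} (e : a ⟶ b) (c : A) :
    IsPullback prod.snd (prod.map (𝟙 c) e) e prod.snd := by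
  refine ⟨⟨by simp⟩, ⟨PullbackCone.IsLimit.mk _
    (fun t => prod.lift (t.snd ≫ prod.fst) t.fst) ?_ ?_ ?_⟩⟩
  · intro t; simp
  · intro t; ext <;> simp [t.condition]
  · intro t m h₁ h₂; ext <;> simp [← h₁, ← h₂]

theorem epi_map {a b a' b' : A} (e : a ⟶ b) (e' : a' ⟶ b') [Epi e] [Epi e'] :
    ∃ _ : Epi (prod.map e e'), δ.deg (prod.map e e') = δ.deg e * δ.deg e' := by
  have h₁ := epi_of_isPullback (isPullback_fst_map e a')
  have h₂ := epi_of_isPullback (isPullback_snd_map e' b)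
  have h : prod.map e (𝟙 a') ≫ prod.map (𝟙 b) e' = prod.map e e' := by simp
  have : Epi (prod.map e e') := h ▸ inferInstance
  refine ⟨this, ?_⟩
  rw [← δ.deg_congr h, δ.deg_comp, δ.deg_pullback (isPullback_fst_map e a'),
    δ.deg_pullback (isPullback_snd_map e' b), mul_comm]

theorem tensor_span {a a' x y x' y' : A} (f : a ⟶ x) (g : a ⟶ y) (f' : a' ⟶ x') (g' : a' ⟶ y') :
    tensor K x y x' y' (spanRel δ f g) (spanRel δ f' g') =
      spanRel δ (prod.map f f') (prod.map g g') := by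
  obtain ⟨r, e, _, rfl, rfl⟩ := spanRel_eq_smul f g
  obtain ⟨s, e', _, rfl, rfl⟩ := spanRel_eq_smul f' g'
  obtain ⟨_, hm⟩ := epi_map δ e e'
  rw [← prod.map_map, ← prod.map_map, spanRel_comp, spanRel_comp, spanRel_comp, spanRel_rel,
    spanRel_rel, spanRel_mk, hm]
  simp [tensor, Rel.prod, mul_comm]

theorem tensor_graph {x y x' y' : A} (f : x ⟶ y) (g : x' ⟶ y') (δ : DegreeFunction A K) :
    tensor K _ _ _ _ (graph K f) (graph K g) = graph K (prod.map f g) := by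
  rw [graph_eq δ, graph_eq δ, graph_eq δ, tensor_span, prod.map_id_id]

theorem tensor_comp {x y z x' y' z' : A} (f : LRel K x y) (g : LRel K y z) (f' : LRel K x' y')
    (g' : LRel K y' z') :
    comp δ _ _ _ (tensor K _ _ _ _ f f') (tensor K _ _ _ _ g g') =
      tensor K _ _ _ _ (comp δ _ _ _ f g) (comp δ _ _ _ f' g') := by
  induction f using span_ind δ with
  | zero => simp
  | add f g hf hg => simp only [map_add, LinearMap.add_apply, hf, hg]
  | smul c f hf => simp only [map_smul, LinearMap.smul_apply, hf]
  | span f₁ f₂ =>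
  induction g using span_ind δ with
  | zero => simp
  | add f g hf hg => simp only [map_add, LinearMap.add_apply, hf, hg]
  | smul c f hf => simp only [map_smul, LinearMap.smul_apply, hf]
  | span g₁ g₂ =>
  induction f' using span_ind δ with
  | zero => simp
  | add f g hf hg => simp only [map_add, LinearMap.add_apply, hf, hg]
  | smul c f hf => simp only [map_smul, LinearMap.smul_apply, hf]
  | span f₁' f₂' =>
  induction g' using span_ind δ with
  | zero => simp
  | add f g hf hg => simp only [map_add, hf, hg]
  | smul c f hf => simp only [map_smul, hf]
  | span g₁' g₂' =>
  have s := IsPullback.of_hasPullback f₂ g₁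
  have s' := IsPullback.of_hasPullback f₂' g₁'
  rw [tensor_span, tensor_span, comp_span δ s, comp_span δ s', comp_span δ (isPullback_map s s'),
    tensor_span]
  simp

theorem associator_nat {x y x' y' x'' y'' : A} (f : LRel K x y) (f' : LRel K x' y')
    (f'' : LRel K x'' y'') :
    comp δ _ _ _ (tensor K _ _ _ _ (tensor K _ _ _ _ f f') f'')
      (graph K (prod.associator y y' y'').hom) =
    comp δ _ _ _ (graph K (prod.associator x x' x'').hom)
      (tensor K _ _ _ _ f (tensor K _ _ _ _ f' f'')) := by
  induction f using span_ind δ with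
  | zero => simp
  | add f g hf hg => simp only [map_add, LinearMap.add_apply, hf, hg]
  | smul c f hf => simp only [map_smul, LinearMap.smul_apply, hf]
  | @span a f₁ f₂ =>
  induction f' using span_ind δ with
  | zero => simp
  | add f g hf hg => simp only [map_add, LinearMap.add_apply, hf, hg]
  | smul c f hf => simp only [map_smul, LinearMap.smul_apply, hf]
  | @span b f₁' f₂' =>
  induction f'' using span_ind δ with
  | zero => simp
  | add f g hf hg => simp only [map_add, LinearMap.add_apply, hf, hg]
  | smul c f hf => simp only [map_smul, LinearMap.smul_apply, hf]
  | @span c f₁'' f₂'' =>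
  rw [tensor_span, tensor_span, tensor_span, tensor_span, span_comp_graph, iso_comp_span,
    ← spanRel_iso δ (prod.associator a b c).hom (_ ≫ _), prod.associator_naturality,
    ← prod.associator_naturality_assoc, IsIso.hom_inv_id, Category.comp_id]

theorem leftUnitor_nat {x y : A} (f : LRel K x y) :
    comp δ _ _ _ (tensor K _ _ _ _ (graph K (𝟙 (⊤_ A))) f) (graph K (prod.leftUnitor y).hom) =
    comp δ _ _ _ (graph K (prod.leftUnitor x).hom) f := by
  induction f using span_ind δ with
  | zero => simp
  | add f g hf hg => simp only [map_add, LinearMap.add_apply, hf, hg]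
  | smul c f hf => simp only [map_smul, LinearMap.smul_apply, hf]
  | @span a f₁ f₂ =>
  rw [graph_eq δ (𝟙 _), tensor_span, span_comp_graph, iso_comp_span,
    ← spanRel_iso δ (prod.leftUnitor a).hom (_ ≫ _), prod.leftUnitor_hom_naturality,
    ← prod.leftUnitor_hom_naturality_assoc, IsIso.hom_inv_id, Category.comp_id]

theorem rightUnitor_nat {x y : A} (f : LRel K x y) :
    comp δ _ _ _ (tensor K _ _ _ _ f (graph K (𝟙 (⊤_ A)))) (graph K (prod.rightUnitor y).hom) =
    comp δ _ _ _ (graph K (prod.rightUnitor x).hom) f := by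
  induction f using span_ind δ with
  | zero => simp
  | add f g hf hg => simp only [map_add, LinearMap.add_apply, hf, hg]
  | smul c f hf => simp only [map_smul, LinearMap.smul_apply, hf]
  | @span a f₁ f₂ =>
  rw [graph_eq δ (𝟙 _), tensor_span, span_comp_graph, iso_comp_span,
    ← spanRel_iso δ (prod.rightUnitor a).hom (_ ≫ _), prod.rightUnitor_hom_naturality,
    ← prod.rightUnitor_hom_naturality_assoc, IsIso.hom_inv_id, Category.comp_id]

theorem braiding_nat {x y x' y' : A} (f : LRel K x y) (f' : LRel K x' y') :
    comp δ _ _ _ (tensor K _ _ _ _ f f') (graph K (prod.braiding y y').hom) =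
    comp δ _ _ _ (graph K (prod.braiding x x').hom) (tensor K _ _ _ _ f' f) := by
  induction f using span_ind δ with
  | zero => simp
  | add f g hf hg => simp only [map_add, LinearMap.add_apply, hf, hg]
  | smul c f hf => simp only [map_smul, LinearMap.smul_apply, hf]
  | @span a f₁ f₂ =>
  induction f' using span_ind δ with
  | zero => simp
  | add f g hf hg => simp only [map_add, LinearMap.add_apply, hf, hg]
  | smul c f hf => simp only [map_smul, LinearMap.smul_apply, hf]
  | @span b f₁' f₂' =>
  rw [tensor_span, tensor_span, span_comp_graph, iso_comp_span,
    ← spanRel_iso δ (prod.braiding a b).hom (_ ≫ _), braid_natural,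
    ← braid_natural_assoc, IsIso.hom_inv_id, Category.comp_id]

theorem pentagon' (w x y z : A) :
    comp δ _ _ _ (tensor K _ _ _ _ (graph K (prod.associator w x y).hom) (graph K (𝟙 z)))
      (comp δ _ _ _ (graph K (prod.associator w (x ⨯ y) z).hom)
        (tensor K _ _ _ _ (graph K (𝟙 w)) (graph K (prod.associator x y z).hom))) =
    comp δ _ _ _ (graph K (prod.associator (w ⨯ x) y z).hom)
      (graph K (prod.associator w x (y ⨯ z)).hom) := by
  simp only [tensor_graph _ _ δ, graph_comp_graph]
  rw [prod.pentagon]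

theorem triangle' (x y : A) :
    comp δ _ _ _ (graph K (prod.associator x (⊤_ A) y).hom)
      (tensor K _ _ _ _ (graph K (𝟙 x)) (graph K (prod.leftUnitor y).hom)) =
    tensor K _ _ _ _ (graph K (prod.rightUnitor x).hom) (graph K (𝟙 y)) := by
  simp only [tensor_graph _ _ δ, graph_comp_graph]
  rw [prod.triangle]

theorem hexagon_forward' (x y z : A) :
    comp δ _ _ _ (graph K (prod.associator x y z).hom) (comp δ _ _ _
      (graph K (prod.braiding x (y ⨯ z)).hom) (graph K (prod.associator y z x).hom)) =
    comp δ _ _ _ (tensor K _ _ _ _ (graph K (prod.braiding x y).hom) (graph K (𝟙 z)))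
      (comp δ _ _ _ (graph K (prod.associator y x z).hom)
        (tensor K _ _ _ _ (graph K (𝟙 y)) (graph K (prod.braiding x z).hom))) := by
  simp only [tensor_graph _ _ δ, graph_comp_graph]
  congr 1
  simp

theorem hexagon_reverse' (x y z : A) :
    comp δ _ _ _ (graph K (prod.associator x y z).inv) (comp δ _ _ _
      (graph K (prod.braiding (x ⨯ y) z).hom) (graph K (prod.associator z x y).inv)) =
    comp δ _ _ _ (tensor K _ _ _ _ (graph K (𝟙 x)) (graph K (prod.braiding y z).hom))
      (comp δ _ _ _ (graph K (prod.associator x z y).inv)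
        (tensor K _ _ _ _ (graph K (prod.braiding x z).hom) (graph K (𝟙 y)))) := by
  simp only [tensor_graph _ _ δ, graph_comp_graph]
  congr 1
  simp

theorem symmetry' (x y : A) :
    comp δ _ _ _ (graph K (prod.braiding x y).hom) (graph K (prod.braiding y x).hom) =
      graph K (𝟙 (x ⨯ y)) := by
  rw [graph_comp_graph, prod.symmetry]

end Construction

/-- Knop's category: the objects are the objects of `A`, and the morphisms from `x` to `y` are the
formal `K`-linear combinations of relations between `x` and `y`. -/
@[ext]
structure T0 {A : Type u} [Category.{v} A] {K : Type w} [Field K] (δ : DegreeFunction A K) where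
  obj : A

namespace T0

variable {A : Type u} [Category.{v} A] [RegularCat A] {K : Type w} [Field K]
  {δ : DegreeFunction A K}

instance : Category.{max u v w} (T0 δ) where
  Hom X Y := LRel K X.obj Y.obj
  id X := graph K (𝟙 X.obj)
  comp f g := comp δ _ _ _ f g
  id_comp f := id_comp' δ f
  comp_id f := comp_id' δ f
  assoc f g h := assoc' δ f g h

instance (X Y : T0 δ) : AddCommGroup (X ⟶ Y) := inferInstanceAs (AddCommGroup (LRel K X.obj Y.obj))

instance (X Y : T0 δ) : Module K (X ⟶ Y) := inferInstanceAs (Module K (LRel K X.obj Y.obj))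

instance : Preadditive (T0 δ) where
  homGroup _ _ := inferInstance
  add_comp X Y Z f g h := comp_add_left (x := X.obj) (y := Y.obj) (z := Z.obj) δ f g h
  comp_add X Y Z f g h := comp_add_right (x := X.obj) (y := Y.obj) (z := Z.obj) δ f g h

instance : Linear K (T0 δ) where
  homModule _ _ := inferInstance
  smul_comp X Y Z c f g := comp_smul_left (x := X.obj) (y := Y.obj) (z := Z.obj) δ c f g
  comp_smul X Y Z f c g := comp_smul_right (x := X.obj) (y := Y.obj) (z := Z.obj) δ c f g

variable (δ) in
/-- The basis morphism given by a relation. -/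
def rel {x y : A} (r : Rel x y) : (⟨x⟩ : T0 δ) ⟶ ⟨y⟩ := (Finsupp.single r 1 : LRel K x y)

variable (δ) in
/-- The functor that sends a morphism to its graph. -/
@[simps]
def Γ : A ⥤ T0 δ where
  obj x := ⟨x⟩
  map f := graph K f
  map_id _ := rfl
  map_comp f g := (graph_comp_graph δ f g).symm

/-- The isomorphism given by the graph of an isomorphism. -/
def ΓIso {X Y : T0 δ} (e : X.obj ≅ Y.obj) : X ≅ Y where
  hom := (Γ δ).map e.hom
  inv := (Γ δ).map e.inv
  hom_inv_id := ((Γ δ).mapIso e).hom_inv_id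
  inv_hom_id := ((Γ δ).mapIso e).inv_hom_id

/-- The tensor product `x ⊗ y = x ⨯ y`. -/
instance : MonoidalCategoryStruct (T0 δ) where
  tensorObj X Y := ⟨X.obj ⨯ Y.obj⟩
  tensorUnit := ⟨⊤_ A⟩
  tensorHom f g := tensor K _ _ _ _ f g
  whiskerLeft X _ _ f := tensor K _ _ _ _ (graph K (𝟙 X.obj)) f
  whiskerRight f Y := tensor K _ _ _ _ f (graph K (𝟙 Y.obj))
  associator X Y Z := ΓIso (prod.associator X.obj Y.obj Z.obj)
  leftUnitor X := ΓIso (prod.leftUnitor X.obj)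
  rightUnitor X := ΓIso (prod.rightUnitor X.obj)

instance : MonoidalCategory (T0 δ) := MonoidalCategory.ofTensorHom
  (id_tensorHom_id := fun X Y => (tensor_graph (𝟙 X.obj) (𝟙 Y.obj) δ).trans (by
    rw [prod.map_id_id]; rfl))
  (id_tensorHom := fun _ _ _ _ => rfl)
  (tensorHom_id := fun _ _ => rfl)
  (tensorHom_comp_tensorHom := fun f f' g g' => tensor_comp δ f g f' g')
  (associator_naturality := fun f f' f'' => associator_nat δ f f' f'')
  (leftUnitor_naturality := fun f => leftUnitor_nat δ f)
  (rightUnitor_naturality := fun f => rightUnitor_nat δ f)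
  (pentagon := fun W X Y Z => pentagon' δ W.obj X.obj Y.obj Z.obj)
  (triangle := fun X Y => triangle' δ X.obj Y.obj)

instance : MonoidalPreadditive (T0 δ) where
  whiskerLeft_zero {X Y Z} := map_zero (tensor K X.obj X.obj Y.obj Z.obj (graph K (𝟙 X.obj)))
  zero_whiskerRight {X Y Z} :=
    LinearMap.map_zero₂ (tensor K Y.obj Z.obj X.obj X.obj) (graph K (𝟙 X.obj))
  whiskerLeft_add {X Y Z} f g :=
    map_add (tensor K X.obj X.obj Y.obj Z.obj (graph K (𝟙 X.obj))) f g
  add_whiskerRight {X Y Z} f g :=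
    LinearMap.map_add₂ (tensor K Y.obj Z.obj X.obj X.obj) f g (graph K (𝟙 X.obj))

instance : MonoidalLinear K (T0 δ) where
  whiskerLeft_smul X _ _ c f := map_smul (tensor K X.obj X.obj _ _ (graph K (𝟙 X.obj))) c f
  smul_whiskerRight c Y Z f X :=
    LinearMap.map_smul₂ (tensor K Y.obj Z.obj X.obj X.obj) c f (graph K (𝟙 X.obj))

instance : SymmetricCategory (T0 δ) where
  braiding X Y := ΓIso (prod.braiding X.obj Y.obj)
  braiding_naturality_right X Y Z f := braiding_nat δ _ f
  braiding_naturality_left f Z := braiding_nat δ f _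
  hexagon_forward X Y Z := hexagon_forward' δ X.obj Y.obj Z.obj
  hexagon_reverse X Y Z := hexagon_reverse' δ X.obj Y.obj Z.obj
  symmetry X Y := symmetry' δ X.obj Y.obj

end T0

section Units

variable {C : Type u} [Category.{v} C] [MonoidalCategory C]

theorem unit_tensor_leftUnitor {X Y : C} {u : 𝟙_ C ⟶ 𝟙_ C} (hu : u = 𝟙 _) (f : X ⟶ Y) :
    (u ⊗ₘ f) ≫ (λ_ Y).hom = (λ_ X).hom ≫ f := by
  subst hu
  rw [id_tensorHom, leftUnitor_naturality]

theorem tensor_unit_rightUnitor {X Y : C} {u : 𝟙_ C ⟶ 𝟙_ C} (hu : u = 𝟙 _) (f : X ⟶ Y) :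
    (f ⊗ₘ u) ≫ (ρ_ Y).hom = (ρ_ X).hom ≫ f := by
  subst hu
  rw [tensorHom_id, rightUnitor_naturality]

end Units

section Mat

variable {C : Type u} [Category.{v} C] [Preadditive C]

instance matLinear (K : Type w) [Field K] [Linear K C] : Linear K (Mat_ C) where
  homModule M N :=
    { smul := fun c f i j => c • f i j
      one_smul := fun f => by ext i j; exact one_smul K (f i j)
      mul_smul := fun a b f => by ext i j; exact mul_smul a b (f i j)
      smul_zero := fun a => by ext i j; exact smul_zero a
      smul_add := fun a f g => by ext i j; exact smul_add a (f i j) (g i j)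
      add_smul := fun a b f => by ext i j; exact add_smul a b (f i j)
      zero_smul := fun f => by ext i j; exact zero_smul K (f i j) }
  smul_comp M N P c f g := by
    ext i k
    change ∑ j, (c • f i j) ≫ g j k = c • ∑ j, f i j ≫ g j k
    simp [Finset.smul_sum]
  comp_smul M N P f c g := by
    ext i k
    change ∑ j, f i j ≫ (c • g j k) = c • ∑ j, f i j ≫ g j k
    simp [Finset.smul_sum]

open Classical in
/-- The matrix with a single nonzero entry `φ i`, in column `e i`, in the row `i`. -/
def monomial {M N : Mat_ C} (e : M.ι → N.ι) (φ : ∀ i, M.X i ⟶ N.X (e i)) : M ⟶ N :=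
  fun i j => if h : e i = j then φ i ≫ eqToHom (congrArg N.X h) else 0

theorem monomial_self {M N : Mat_ C} (e : M.ι → N.ι) (φ : ∀ i, M.X i ⟶ N.X (e i)) (i : M.ι) :
    monomial e φ i (e i) = φ i := by simp [monomial]

theorem monomial_ne {M N : Mat_ C} (e : M.ι → N.ι) (φ : ∀ i, M.X i ⟶ N.X (e i)) {i : M.ι} {j : N.ι}
    (h : e i ≠ j) : monomial e φ i j = 0 := by simp [monomial, h]

theorem monomial_comp {M N P : Mat_ C} (e : M.ι → N.ι) (φ : ∀ i, M.X i ⟶ N.X (e i)) (f : N ⟶ P)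
    (i : M.ι) (k : P.ι) : (monomial e φ ≫ f) i k = φ i ≫ f (e i) k := by
  rw [Mat_.comp_apply, Finset.sum_eq_single (e i), monomial_self]
  · intro j _ h; rw [monomial_ne e φ h.symm, zero_comp]
  · simp

theorem comp_monomial {M N P : Mat_ C} (e : N.ι → P.ι) (he : e.Injective)
    (φ : ∀ i, N.X i ⟶ P.X (e i)) (f : M ⟶ N) (i : M.ι) (j : N.ι) :
    (f ≫ monomial e φ) i (e j) = f i j ≫ φ j := by
  rw [Mat_.comp_apply, Finset.sum_eq_single j, monomial_self]
  · intro j' _ h; rw [monomial_ne e φ (fun h' => h (he h')), comp_zero]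
  · simp

theorem monomial_comp_monomial {M N P : Mat_ C} (e : M.ι → N.ι) (φ : ∀ i, M.X i ⟶ N.X (e i))
    (e' : N.ι → P.ι) (φ' : ∀ i, N.X i ⟶ P.X (e' i)) :
    monomial e φ ≫ monomial e' φ' = monomial (fun i => e' (e i)) (fun i => φ i ≫ φ' (e i)) := by
  ext i k
  rw [monomial_comp]
  by_cases h : e' (e i) = k
  · subst h; rw [monomial_self, monomial_self (fun i => e' (e i))]
  · rw [monomial_ne e' φ' h, monomial_ne (fun i => e' (e i)) _ h, comp_zero]

theorem monomial_id (M : Mat_ C) : monomial (fun i => i) (fun i => 𝟙 (M.X i)) = 𝟙 M := by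
  ext i j
  by_cases h : i = j
  · subst h; rw [monomial_self (fun i => i), Mat_.id_apply_self]
  · rw [monomial_ne (fun i => i) _ h, Mat_.id_apply_of_ne _ _ _ h]

theorem monomial_eq_id {M : Mat_ C} (φ : ∀ i, M.X i ⟶ M.X i) (h : ∀ i, φ i = 𝟙 _) :
    monomial (fun i => i) φ = 𝟙 M := by
  rw [← monomial_id]
  exact congrArg _ (funext h)
/-- An isomorphism in a category of matrices given by a reindexing and entrywise isomorphisms. -/
def reindexIso {M N : Mat_ C} (e : M.ι → N.ι) (e' : N.ι → M.ι) (φ : ∀ i, M.X i ⟶ N.X (e i))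
    (φ' : ∀ i, N.X i ⟶ M.X (e' i))
    (h : monomial (fun i => e' (e i)) (fun i => φ i ≫ φ' (e i)) = 𝟙 M)
    (h' : monomial (fun i => e (e' i)) (fun i => φ' i ≫ φ (e' i)) = 𝟙 N) : M ≅ N where
  hom := monomial e φ
  inv := monomial e' φ'
  hom_inv_id := by rw [monomial_comp_monomial, h]
  inv_hom_id := by rw [monomial_comp_monomial, h']

variable [MonoidalCategory C]

/-- The tensor product of formal direct sums. -/
instance matTensor : MonoidalCategoryStruct (Mat_ C) where
  tensorObj M N := ⟨M.ι × N.ι, fun i => M.X i.1 ⊗ N.X i.2⟩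
  tensorUnit := ⟨Unit, fun _ => 𝟙_ C⟩
  tensorHom f g := fun i j => f i.1 j.1 ⊗ₘ g i.2 j.2
  whiskerLeft M _ _ f := fun i j => (𝟙 M : M ⟶ M) i.1 j.1 ⊗ₘ f i.2 j.2
  whiskerRight f M := fun i j => f i.1 j.1 ⊗ₘ (𝟙 M : M ⟶ M) i.2 j.2
  associator M N P := reindexIso (fun i => (i.1.1, (i.1.2, i.2))) (fun i => ((i.1, i.2.1), i.2.2))
    (fun i => (α_ (M.X i.1.1) (N.X i.1.2) (P.X i.2)).hom)
    (fun i => (α_ (M.X i.1) (N.X i.2.1) (P.X i.2.2)).inv)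
    (by simp only [Iso.hom_inv_id]; exact monomial_id _)
    (by simp only [Iso.inv_hom_id]; exact monomial_id _)
  leftUnitor M := reindexIso (fun i => i.2) (fun i => ((), i))
    (fun i => (λ_ (M.X i.2)).hom) (fun i => (λ_ (M.X i)).inv)
    (by simp only [Iso.hom_inv_id]; exact monomial_id _)
    (by simp only [Iso.inv_hom_id]; exact monomial_id _)
  rightUnitor M := reindexIso (fun i => i.1) (fun i => (i, ()))
    (fun i => (ρ_ (M.X i.1)).hom) (fun i => (ρ_ (M.X i)).inv)
    (by simp only [Iso.hom_inv_id]; exact monomial_id _)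
    (by simp only [Iso.inv_hom_id]; exact monomial_id _)

theorem mat_tensorHom_apply {M N P Q : Mat_ C} (f : M ⟶ N) (g : P ⟶ Q) (i : M.ι × P.ι)
    (j : N.ι × Q.ι) : (f ⊗ₘ g) i j = f i.1 j.1 ⊗ₘ g i.2 j.2 := rfl

theorem mat_unit_apply :
    (𝟙 (𝟙_ (Mat_ C)) : 𝟙_ (Mat_ C) ⟶ 𝟙_ (Mat_ C)) () () = 𝟙 (𝟙_ C) :=
  Mat_.id_apply_self (⟨Unit, fun _ => 𝟙_ C⟩ : Mat_ C) ()

variable [MonoidalPreadditive C]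

theorem monomial_tensor {M N P Q : Mat_ C} (e : M.ι → N.ι) (φ : ∀ i, M.X i ⟶ N.X (e i))
    (e' : P.ι → Q.ι) (φ' : ∀ i, P.X i ⟶ Q.X (e' i)) :
    monomial e φ ⊗ₘ monomial e' φ' = monomial (M := M ⊗ P) (N := N ⊗ Q)
      (fun i => (e i.1, e' i.2)) (fun i => φ i.1 ⊗ₘ φ' i.2) := by
  ext ⟨i, i'⟩ ⟨k, k'⟩
  rw [mat_tensorHom_apply]
  by_cases h : e i = k
  · subst h
    by_cases h : e' i' = k'
    · subst h
      rw [monomial_self, monomial_self]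
      exact (monomial_self (M := M ⊗ P) (N := N ⊗ Q) (fun i => (e i.1, e' i.2))
        (fun i => φ i.1 ⊗ₘ φ' i.2) (i, i')).symm
    · rw [monomial_ne e' φ' h, MonoidalPreadditive.tensor_zero]
      exact (monomial_ne (M := M ⊗ P) (N := N ⊗ Q) (fun i => (e i.1, e' i.2)) _
        (fun h' => h (Prod.ext_iff.1 h').2)).symm
  · rw [monomial_ne e φ h, MonoidalPreadditive.zero_tensor]
    exact (monomial_ne (M := M ⊗ P) (N := N ⊗ Q) (fun i => (e i.1, e' i.2)) _
      (fun h' => h (Prod.ext_iff.1 h').1)).symm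

theorem mat_tensor_comp {M N P M' N' P' : Mat_ C} (f : M ⟶ N) (f' : M' ⟶ N') (g : N ⟶ P)
    (g' : N' ⟶ P') : (f ⊗ₘ f') ≫ (g ⊗ₘ g') = (f ≫ g) ⊗ₘ (f' ≫ g') := by
  ext ⟨i, i'⟩ ⟨k, k'⟩
  rw [Mat_.comp_apply, mat_tensorHom_apply, Mat_.comp_apply, Mat_.comp_apply, sum_tensor]
  simp only [tensor_sum, ← tensorHom_comp_tensorHom]
  exact Fintype.sum_prod_type _

instance matMonoidal : MonoidalCategory (Mat_ C) := MonoidalCategory.ofTensorHom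
  (id_tensorHom_id := fun M N => by
    rw [← monomial_id M, ← monomial_id N, monomial_tensor]
    simp only [id_tensorHom_id]
    exact monomial_id _)
  (id_tensorHom := fun _ _ _ _ => rfl)
  (tensorHom_id := fun _ _ => rfl)
  (tensorHom_comp_tensorHom := mat_tensor_comp)
  (associator_naturality := fun {X₁ X₂ X₃ Y₁ Y₂ Y₃} f g h => by
    ext ⟨⟨i, j⟩, k⟩ ⟨i', j', k'⟩
    refine (comp_monomial (N := (Y₁ ⊗ Y₂) ⊗ Y₃) _ ?_ _ _ _ ((i', j'), k')).trans
      (Eq.trans ?_ (monomial_comp _ _ _ _ _).symm)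
    · exact Function.LeftInverse.injective (g := fun j => ((j.1, j.2.1), j.2.2)) fun _ => rfl
    · exact associator_naturality _ _ _)
  (leftUnitor_naturality := fun {X Y} f => by
    ext ⟨_, i⟩ k
    refine (comp_monomial (N := 𝟙_ (Mat_ C) ⊗ Y) _ ?_ _ _ _ ((), k)).trans (Eq.trans ?_ (monomial_comp _ _ _ _ _).symm)
    · exact Function.LeftInverse.injective (g := fun j => ((), j)) fun _ => rfl
    · exact unit_tensor_leftUnitor mat_unit_apply (f i k))
  (rightUnitor_naturality := fun {X Y} f => by
    ext ⟨i, _⟩ k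
    refine (comp_monomial (N := Y ⊗ 𝟙_ (Mat_ C)) _ ?_ _ _ _ (k, ())).trans (Eq.trans ?_ (monomial_comp _ _ _ _ _).symm)
    · exact Function.LeftInverse.injective (g := fun j => (j, ())) fun _ => rfl
    · exact tensor_unit_rightUnitor mat_unit_apply (f i k))
  (pentagon := fun W X Y Z => by
    rw [← monomial_id Z, ← monomial_id W]
    change (monomial _ _ ⊗ₘ _) ≫ monomial _ _ ≫ (_ ⊗ₘ monomial _ _) = monomial _ _ ≫ monomial _ _
    rw [monomial_tensor, monomial_tensor, monomial_comp_monomial, monomial_comp_monomial,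
      monomial_comp_monomial]
    congr 1
    funext i
    rw [tensorHom_id, id_tensorHom]
    exact MonoidalCategory.pentagon _ _ _ _)
  (triangle := fun X Y => by
    rw [← monomial_id X, ← monomial_id Y]
    change monomial _ _ ≫ (_ ⊗ₘ monomial _ _) = (monomial _ _ ⊗ₘ _)
    rw [monomial_tensor, monomial_tensor, monomial_comp_monomial]
    congr 1
    funext i
    rw [tensorHom_id, id_tensorHom]
    exact MonoidalCategory.triangle _ _)

instance : MonoidalPreadditive (Mat_ C) where
  whiskerLeft_zero := by intros; ext i j; exact MonoidalPreadditive.tensor_zero _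
  zero_whiskerRight := by intros; ext i j; exact MonoidalPreadditive.zero_tensor _
  whiskerLeft_add _ _ := by ext i j; exact MonoidalPreadditive.tensor_add _ _ _
  add_whiskerRight _ _ := by ext i j; exact MonoidalPreadditive.add_tensor _ _ _

instance matMonoidalLinear (K : Type w) [Field K] [Linear K C] [MonoidalLinear K C] :
    MonoidalLinear K (Mat_ C) where
  whiskerLeft_smul X _ _ c f := by
    ext i j
    change (𝟙 X : X ⟶ X) i.1 j.1 ⊗ₘ (c • f i.2 j.2) = c • ((𝟙 X : X ⟶ X) i.1 j.1 ⊗ₘ f i.2 j.2)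
    simp [MonoidalCategory.tensorHom_def]
  smul_whiskerRight c _ _ f X := by
    ext i j
    change (c • f i.1 j.1) ⊗ₘ (𝟙 X : X ⟶ X) i.2 j.2 = c • (f i.1 j.1 ⊗ₘ (𝟙 X : X ⟶ X) i.2 j.2)
    simp [MonoidalCategory.tensorHom_def]

instance matSymmetric [SymmetricCategory C] : SymmetricCategory (Mat_ C) where
  braiding M N := reindexIso (fun i => (i.2, i.1)) (fun i => (i.2, i.1))
    (fun i => (β_ (M.X i.1) (N.X i.2)).hom) (fun i => (β_ (M.X i.2) (N.X i.1)).inv)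
    (by simp only [Iso.hom_inv_id]; exact monomial_id _)
    (by simp only [Iso.inv_hom_id]; exact monomial_id _)
  braiding_naturality_right M N P f := by
    ext ⟨i, j⟩ ⟨k, l⟩
    refine (comp_monomial (N := M ⊗ P) _ ?_ _ _ _ (l, k)).trans (Eq.trans ?_ (monomial_comp _ _ _ _ _).symm)
    · exact Function.LeftInverse.injective (g := fun j => (j.2, j.1)) fun _ => rfl
    · exact BraidedCategory.braiding_naturality _ _
  braiding_naturality_left {M N} f P := by
    ext ⟨i, j⟩ ⟨k, l⟩
    refine (comp_monomial (N := N ⊗ P) _ ?_ _ _ _ (l, k)).trans (Eq.trans ?_ (monomial_comp _ _ _ _ _).symm)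
    · exact Function.LeftInverse.injective (g := fun j => (j.2, j.1)) fun _ => rfl
    · exact BraidedCategory.braiding_naturality _ _
  hexagon_forward X Y Z := by
    rw [← tensorHom_id, ← id_tensorHom, ← monomial_id Z, ← monomial_id Y]
    change monomial _ _ ≫ monomial _ _ ≫ monomial _ _ =
      (monomial _ _ ⊗ₘ _) ≫ monomial _ _ ≫ (_ ⊗ₘ monomial _ _)
    rw [monomial_tensor, monomial_tensor, monomial_comp_monomial, monomial_comp_monomial,
      monomial_comp_monomial, monomial_comp_monomial]
    congr 1
    funext i
    rw [tensorHom_id, id_tensorHom]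
    exact BraidedCategory.hexagon_forward _ _ _
  hexagon_reverse X Y Z := by
    rw [← tensorHom_id, ← id_tensorHom, ← monomial_id X, ← monomial_id Y]
    change monomial _ _ ≫ monomial _ _ ≫ monomial _ _ =
      (_ ⊗ₘ monomial _ _) ≫ monomial _ _ ≫ (monomial _ _ ⊗ₘ _)
    rw [monomial_tensor, monomial_tensor, monomial_comp_monomial, monomial_comp_monomial,
      monomial_comp_monomial, monomial_comp_monomial]
    congr 1
    funext i
    rw [tensorHom_id, id_tensorHom]
    exact BraidedCategory.hexagon_reverse _ _ _
  symmetry X Y := by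
    change monomial _ _ ≫ monomial _ _ = _
    rw [monomial_comp_monomial]
    simp only [SymmetricCategory.symmetry]
    exact monomial_id _

end Mat

section Karoubi

open Idempotents

variable {C : Type u} [Category.{v} C]

/-- A morphism of the underlying objects that commutes with the idempotents induces a morphism of
the direct summands. -/
def karHom {P Q : Karoubi C} (f : P.X ⟶ Q.X) (h : P.p ≫ f = f ≫ Q.p) : P ⟶ Q :=
  ⟨P.p ≫ f, by
    rw [Category.assoc, ← h, reassoc_of% P.idem, reassoc_of% P.idem]⟩

theorem karHom_comp {P Q R : Karoubi C} (f : P.X ⟶ Q.X) (h : P.p ≫ f = f ≫ Q.p) (g : Q.X ⟶ R.X)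
    (h' : Q.p ≫ g = g ≫ R.p) :
    karHom f h ≫ karHom g h' = karHom (f ≫ g) (by rw [reassoc_of% h, h', Category.assoc]) := by
  ext
  simp [karHom, ← reassoc_of% h]

theorem karHom_congr {P Q : Karoubi C} {f g : P.X ⟶ Q.X} (e : f = g) {h : P.p ≫ f = f ≫ Q.p}
    {h' : P.p ≫ g = g ≫ Q.p} : karHom f h = karHom g h' := by
  subst e; rfl

theorem karHom_id (P : Karoubi C) : karHom (𝟙 P.X) (by simp) = 𝟙 P := by
  ext
  simp [karHom]

/-- An isomorphism of the underlying objects that commutes with the idempotents induces an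
isomorphism of the direct summands. -/
def karIso {P Q : Karoubi C} (e : P.X ≅ Q.X) (h : P.p ≫ e.hom = e.hom ≫ Q.p) : P ≅ Q where
  hom := karHom e.hom h
  inv := karHom e.inv (by rw [Iso.eq_inv_comp, ← reassoc_of% h, e.hom_inv_id, Category.comp_id])
  hom_inv_id := by
    rw [karHom_comp, ← karHom_id]
    exact karHom_congr e.hom_inv_id
  inv_hom_id := by
    rw [karHom_comp, ← karHom_id]
    exact karHom_congr e.inv_hom_id

theorem kar_natural {P Q P' Q' : Karoubi C} (f : P ⟶ P') (g : Q ⟶ Q') (e : P.X ⟶ Q.X)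
    (h : P.p ≫ e = e ≫ Q.p) (e' : P'.X ⟶ Q'.X) (h' : P'.p ≫ e' = e' ≫ Q'.p)
    (w : f.f ≫ e' = e ≫ g.f) : f ≫ karHom e' h' = karHom e h ≫ g := by
  ext
  simp [karHom, w, reassoc_of% h]

variable [MonoidalCategory C]

theorem kar_tensor_aux {P P' Q Q' : Karoubi C} (f : P ⟶ P') (g : Q ⟶ Q') :
    (P.p ⊗ₘ Q.p) ≫ (f.f ⊗ₘ g.f) ≫ (P'.p ⊗ₘ Q'.p) = f.f ⊗ₘ g.f := by
  rw [tensorHom_comp_tensorHom, tensorHom_comp_tensorHom]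
  simp

/-- The tensor product of direct summands. -/
instance karTensor : MonoidalCategoryStruct (Karoubi C) where
  tensorObj P Q := ⟨P.X ⊗ Q.X, P.p ⊗ₘ Q.p, by rw [tensorHom_comp_tensorHom, P.idem, Q.idem]⟩
  tensorUnit := ⟨𝟙_ C, 𝟙 _, by simp⟩
  tensorHom f g := ⟨f.f ⊗ₘ g.f, kar_tensor_aux f g⟩
  whiskerLeft P _ _ f := ⟨P.p ⊗ₘ f.f, kar_tensor_aux (𝟙 P) f⟩
  whiskerRight f P := ⟨f.f ⊗ₘ P.p, kar_tensor_aux f (𝟙 P)⟩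
  associator P Q R := karIso (α_ P.X Q.X R.X) (associator_naturality _ _ _)
  leftUnitor P := karIso (λ_ P.X) (unit_tensor_leftUnitor rfl P.p)
  rightUnitor P := karIso (ρ_ P.X) (tensor_unit_rightUnitor rfl P.p)

theorem karHom_tensor {P Q P' Q' : Karoubi C} (f : P.X ⟶ Q.X) (h : P.p ≫ f = f ≫ Q.p)
    (f' : P'.X ⟶ Q'.X) (h' : P'.p ≫ f' = f' ≫ Q'.p) :
    karHom f h ⊗ₘ karHom f' h' = karHom (P := P ⊗ P') (Q := Q ⊗ Q') (f ⊗ₘ f')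
      (show (P.p ⊗ₘ P'.p) ≫ _ = _ ≫ (Q.p ⊗ₘ Q'.p) by
        rw [tensorHom_comp_tensorHom, tensorHom_comp_tensorHom, h, h']) := by
  ext
  exact (tensorHom_comp_tensorHom _ _ _ _).symm

theorem kar_associator (P Q R : Karoubi C) : (α_ P Q R).hom =
    karHom (P := (P ⊗ Q) ⊗ R) (Q := P ⊗ Q ⊗ R) (α_ P.X Q.X R.X).hom
      (associator_naturality P.p Q.p R.p) := rfl

theorem kar_associator_inv (P Q R : Karoubi C) : (α_ P Q R).inv =
    karHom (P := P ⊗ Q ⊗ R) (Q := (P ⊗ Q) ⊗ R) (α_ P.X Q.X R.X).inv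
      (associator_inv_naturality P.p Q.p R.p) := rfl

theorem kar_leftUnitor (P : Karoubi C) : (λ_ P).hom =
    karHom (P := 𝟙_ _ ⊗ P) (λ_ P.X).hom (unit_tensor_leftUnitor rfl P.p) := rfl

theorem kar_rightUnitor (P : Karoubi C) : (ρ_ P).hom =
    karHom (P := P ⊗ 𝟙_ _) (ρ_ P.X).hom (tensor_unit_rightUnitor rfl P.p) := rfl

instance karMonoidal : MonoidalCategory (Karoubi C) := MonoidalCategory.ofTensorHom
  (id_tensorHom_id := fun _ _ => rfl)
  (id_tensorHom := by intros; rfl)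
  (tensorHom_id := by intros; rfl)
  (tensorHom_comp_tensorHom := by intros; ext; exact tensorHom_comp_tensorHom _ _ _ _)
  (associator_naturality := fun {X₁ X₂ X₃ Y₁ Y₂ Y₃} f g h => kar_natural (P := (X₁ ⊗ X₂) ⊗ X₃) (Q := X₁ ⊗ X₂ ⊗ X₃) (P' := (Y₁ ⊗ Y₂) ⊗ Y₃) (Q' := Y₁ ⊗ Y₂ ⊗ Y₃) _ _ _
    (associator_naturality X₁.p X₂.p X₃.p) _ (associator_naturality Y₁.p Y₂.p Y₃.p)
    (associator_naturality _ _ _))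
  (leftUnitor_naturality := fun {X Y} f => kar_natural (P := 𝟙_ _ ⊗ X) (P' := 𝟙_ _ ⊗ Y) _ _ _
    (unit_tensor_leftUnitor rfl X.p) _ (unit_tensor_leftUnitor rfl Y.p)
    (unit_tensor_leftUnitor rfl f.f))
  (rightUnitor_naturality := fun {X Y} f => kar_natural (P := X ⊗ 𝟙_ _) (P' := Y ⊗ 𝟙_ _) _ _ _
    (tensor_unit_rightUnitor rfl X.p) _ (tensor_unit_rightUnitor rfl Y.p)
    (tensor_unit_rightUnitor rfl f.f))
  (pentagon := fun W X Y Z => by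
    rw [← karHom_id W, ← karHom_id Z]
    simp only [kar_associator]
    rw [karHom_tensor, karHom_tensor, karHom_comp, karHom_comp, karHom_comp]
    refine karHom_congr ?_
    rw [tensorHom_id, id_tensorHom]
    exact MonoidalCategory.pentagon _ _ _ _)
  (triangle := fun X Y => by
    rw [← karHom_id X, ← karHom_id Y]
    simp only [kar_associator, kar_leftUnitor, kar_rightUnitor]
    rw [karHom_tensor, karHom_tensor, karHom_comp]
    refine karHom_congr ?_
    rw [tensorHom_id, id_tensorHom]
    exact MonoidalCategory.triangle _ _)

/-- The braiding of the Karoubi envelope. -/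
def karBraiding [SymmetricCategory C] (P Q : Karoubi C) : P ⊗ Q ≅ Q ⊗ P :=
  karIso (P := P ⊗ Q) (Q := Q ⊗ P) (β_ P.X Q.X) (BraidedCategory.braiding_naturality P.p Q.p)

theorem karBraiding_hom [SymmetricCategory C] (P Q : Karoubi C) : (karBraiding P Q).hom =
    karHom (P := P ⊗ Q) (Q := Q ⊗ P) (β_ P.X Q.X).hom
      (BraidedCategory.braiding_naturality P.p Q.p) := rfl

instance karSymmetric [SymmetricCategory C] : SymmetricCategory (Karoubi C) where
  braiding := karBraiding
  braiding_naturality_right X Y Z f := kar_natural (X ◁ f) (f ▷ X) _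
    (BraidedCategory.braiding_naturality X.p Y.p) _ (BraidedCategory.braiding_naturality X.p Z.p)
    (BraidedCategory.braiding_naturality X.p f.f)
  braiding_naturality_left {X Y} f Z := kar_natural (f ▷ Z) (Z ◁ f) _
    (BraidedCategory.braiding_naturality X.p Z.p) _ (BraidedCategory.braiding_naturality Y.p Z.p)
    (BraidedCategory.braiding_naturality f.f Z.p)
  hexagon_forward X Y Z := by
    rw [← tensorHom_id, ← id_tensorHom, ← karHom_id Z, ← karHom_id Y]
    simp only [kar_associator, karBraiding_hom]
    rw [karHom_tensor, karHom_tensor, karHom_comp, karHom_comp, karHom_comp, karHom_comp]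
    refine karHom_congr ?_
    rw [tensorHom_id, id_tensorHom]
    exact BraidedCategory.hexagon_forward _ _ _
  hexagon_reverse X Y Z := by
    rw [← tensorHom_id, ← id_tensorHom, ← karHom_id X, ← karHom_id Y]
    simp only [kar_associator_inv, karBraiding_hom]
    rw [karHom_tensor, karHom_tensor, karHom_comp, karHom_comp, karHom_comp, karHom_comp]
    refine karHom_congr ?_
    rw [tensorHom_id, id_tensorHom]
    exact BraidedCategory.hexagon_reverse _ _ _
  symmetry X Y := by
    rw [karBraiding_hom, karBraiding_hom, karHom_comp, ← karHom_id]
    exact karHom_congr (SymmetricCategory.symmetry _ _)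

variable [Preadditive C]

instance karLinear (K : Type w) [Field K] [Linear K C] : Linear K (Karoubi C) where
  homModule P Q :=
    { smul := fun c f => ⟨c • f.f, by simp⟩
      one_smul := fun f => by ext; exact one_smul K f.f
      mul_smul := fun a b f => by ext; exact mul_smul a b f.f
      smul_zero := fun a => by ext; exact smul_zero a
      smul_add := fun a f g => by ext; exact smul_add a f.f g.f
      add_smul := fun a b f => by ext; exact add_smul a b f.f
      zero_smul := fun f => by ext; exact zero_smul K f.f }
  smul_comp P Q R c f g := by ext; exact Linear.smul_comp _ _ _ c f.f g.f
  comp_smul P Q R f c g := by ext; exact Linear.comp_smul _ _ _ f.f c g.f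



instance [MonoidalPreadditive C] : MonoidalPreadditive (Karoubi C) where
  whiskerLeft_zero := by intros; ext; exact MonoidalPreadditive.tensor_zero _
  zero_whiskerRight := by intros; ext; exact MonoidalPreadditive.zero_tensor _
  whiskerLeft_add _ _ := by ext; exact MonoidalPreadditive.tensor_add _ _ _
  add_whiskerRight _ _ := by ext; exact MonoidalPreadditive.add_tensor _ _ _

instance karMonoidalLinear (K : Type w) [Field K] [Linear K C] [MonoidalPreadditive C]
    [MonoidalLinear K C] : MonoidalLinear K (Karoubi C) where
  whiskerLeft_smul P _ _ c f := by
    ext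
    change P.p ⊗ₘ (c • f.f) = c • (P.p ⊗ₘ f.f)
    simp [MonoidalCategory.tensorHom_def]
  smul_whiskerRight c _ _ f P := by
    ext
    change (c • f.f) ⊗ₘ P.p = c • (f.f ⊗ₘ P.p)
    simp [MonoidalCategory.tensorHom_def]

end Karoubi

section DeligneKnop

open Idempotents

variable {A : Type u} [Category.{v} A] [RegularCat A] {K : Type w} [Field K]

/-- The Deligne–Knop category of a regular category with a degree function: the additive Karoubi
completion of `T0 δ`. For `δ = degSets t` this is Deligne's category `Rep(S_t)`. -/
abbrev Del (δ : DegreeFunction A K) := Karoubi (Mat_ (T0 δ))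

/-- The embedding of `T0 δ` into its additive Karoubi completion. -/
def ι (δ : DegreeFunction A K) : T0 δ ⥤ Del δ := Mat_.embedding (T0 δ) ⋙ toKaroubi _

/-- The object `[x]`. -/
def brk (δ : DegreeFunction A K) (x : A) : Del δ := (ι δ).obj ⟨x⟩

/-- The morphism `⟨r⟩ : [x] ⟶ [y]`. -/
def basisHom (δ : DegreeFunction A K) {x y : A} (r : Rel x y) : brk δ x ⟶ brk δ y :=
  (ι δ).map (T0.rel δ r)

/-- The functor `Γ` from `A` to the Deligne–Knop category: `x ↦ [x]`, and a morphism is sent to its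
graph. -/
def Γ (δ : DegreeFunction A K) : A ⥤ Del δ := T0.Γ δ ⋙ ι δ

/-- The canonical isomorphism `[x] ⊗ [y] ≅ [x × y]`. -/
def brkTensor (δ : DegreeFunction A K) (x y : A) : brk δ x ⊗ brk δ y ≅ brk δ (x ⨯ y) :=
  karIso (P := brk δ x ⊗ brk δ y) (Q := brk δ (x ⨯ y))
    (reindexIso
      (M := (Mat_.embedding (T0 δ)).obj ⟨x⟩ ⊗ (Mat_.embedding (T0 δ)).obj ⟨y⟩)
      (N := (Mat_.embedding (T0 δ)).obj ⟨x ⨯ y⟩)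
      (fun _ => PUnit.unit) (fun _ => (PUnit.unit, PUnit.unit))
      (fun _ => 𝟙 (⟨x ⨯ y⟩ : T0 δ)) (fun _ => 𝟙 (⟨x ⨯ y⟩ : T0 δ))
      (monomial_eq_id _ fun _ => Category.comp_id _)
      (monomial_eq_id _ fun _ => Category.comp_id _))
    (by
      change (𝟙 _ ⊗ₘ 𝟙 _) ≫ _ = _ ≫ 𝟙 _
      rw [id_tensorHom_id, Category.id_comp, Category.comp_id])

/-- The canonical isomorphism `𝟙 ≅ [⊤]`. -/
def brkUnit (δ : DegreeFunction A K) : 𝟙_ (Del δ) ≅ brk δ (⊤_ A) :=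
  karIso (P := 𝟙_ (Del δ)) (Q := brk δ (⊤_ A))
    (reindexIso
      (M := 𝟙_ (Mat_ (T0 δ))) (N := (Mat_.embedding (T0 δ)).obj ⟨⊤_ A⟩)
      (fun _ => PUnit.unit) (fun _ => ())
      (fun _ => 𝟙 (⟨⊤_ A⟩ : T0 δ)) (fun _ => 𝟙 (⟨⊤_ A⟩ : T0 δ))
      (monomial_eq_id _ fun _ => Category.comp_id _)
      (monomial_eq_id _ fun _ => Category.comp_id _))
    (by
      change 𝟙 _ ≫ _ = _ ≫ 𝟙 _
      rw [Category.id_comp, Category.comp_id])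

variable {A' : Type u'} [Category.{v'} A'] [RegularCat A']

/-- A functor preserves degree functions if it maps epimorphisms to epimorphisms of the same
degree. -/
def PreservesDegree (F : A ⥤ A') (δ : DegreeFunction A K) (δ' : DegreeFunction A' K) : Prop :=
  ∀ ⦃x y : A⦄ (e : x ⟶ y) [Epi e], ∃ _ : Epi (F.map e), δ'.deg (F.map e) = δ.deg e

/-- The relation `F r` between `F x` and `F y` given by a relation `r` between `x` and `y`: the image
of `F r ⟶ F x ⨯ F y`, which is a monomorphism if `F` preserves pullbacks. -/
def mapRel (F : A ⥤ A') {x y : A} (r : Rel x y) : Rel (F.obj x) (F.obj y) :=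
  imageSubobject (prod.lift (F.map r.p) (F.map r.q))

/-- A `K`-linear symmetric monoidal functor between Deligne–Knop categories that is given by
`[x] ↦ [F x]` and `⟨r⟩ ↦ ⟨F r⟩`, with the monoidal structure coming from `F (x × y) ≅ F x × F y`
and `F ⊤ ≅ ⊤`. -/
structure InducedFunctor (F : A ⥤ A') (δ : DegreeFunction A K) (δ' : DegreeFunction A' K) where
  functor : Del δ ⥤ Del δ'
  additive : functor.Additive
  linear : functor.Linear K
  braided : functor.Braided
  objIso (x : A) : functor.obj (brk δ x) ≅ brk δ' (F.obj x)
  map_basisHom {x y : A} (r : Rel x y) :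
    functor.map (basisHom δ r) ≫ (objIso y).hom = (objIso x).hom ≫ basisHom δ' (mapRel F r)
  tensor_comp (x y : A) :
    Functor.LaxMonoidal.μ functor (brk δ x) (brk δ y) ≫ functor.map (brkTensor δ x y).hom ≫
        (objIso (x ⨯ y)).hom ≫ (Γ δ').map (prodComparison F x y) =
      ((objIso x).hom ⊗ₘ (objIso y).hom) ≫ (brkTensor δ' (F.obj x) (F.obj y)).hom
  unit_comp :
    Functor.LaxMonoidal.ε functor ≫ functor.map (brkUnit δ).hom ≫ (objIso (⊤_ A)).hom ≫
        (Γ δ').map (terminal.from (F.obj (⊤_ A))) = (brkUnit δ').hom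

end DeligneKnop

section OpRegular

theorem hasImages_of_factor {A : Type u} [Category.{v} A] [HasFiniteLimits A] [Balanced A]
    (fac : ∀ {x y : A} (f : x ⟶ y), ∃ (z : A) (e : x ⟶ z) (m : z ⟶ y), Epi e ∧ Mono m ∧ e ≫ m = f) :
    HasImages A where
  has_image {x y} f := by
    obtain ⟨z, e, m, he, hm, h⟩ := fac f
    have key (F' : MonoFactorisation f) : IsIso (pullback.snd F'.m m) := by
      have := F'.m_mono
      let l : x ⟶ pullback F'.m m := pullback.lift F'.e e (by rw [F'.fac, h])
      have hl : l ≫ pullback.snd F'.m m = e := pullback.lift_snd _ _ _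
      have : Epi (l ≫ pullback.snd F'.m m) := hl ▸ he
      have : Epi (pullback.snd F'.m m) := epi_of_epi l _
      exact isIso_of_mono_of_epi _
    exact ⟨⟨⟨⟨z, m, e, h⟩,
      { lift := fun F' => have := key F'; inv (pullback.snd F'.m m) ≫ pullback.fst F'.m m
        lift_fac := fun F' => by
          have := key F'
          simp [pullback.condition] }⟩⟩⟩

theorem regularCat_op {C : Type u} [Category.{v} C] [HasFiniteColimits C] [Adhesive C]
    (fac : ∀ {x y : C} (f : x ⟶ y), ∃ (z : C) (e : x ⟶ z) (m : z ⟶ y), Epi e ∧ Mono m ∧ e ≫ m = f) :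
    RegularCat Cᵒᵖ := by
  have : Balanced C := inferInstance
  have : Balanced Cᵒᵖ := inferInstance
  refine ⟨inferInstance, hasImages_of_factor fun {x y} f => ?_, inferInstance, fun {x y z} f g _ => ?_⟩
  · obtain ⟨z, e, m, he, hm, h⟩ := fac f.unop
    exact ⟨.op z, m.op, e.op, inferInstance, inferInstance, by rw [← op_comp, h, Quiver.Hom.op_unop]⟩
  · have := Adhesive.mono_of_isPushout_of_mono_left (IsPullback.of_hasPullback f g).flip.unop
    exact unop_mono_iff _ |>.1 this

instance : Adhesive FintypeCat.{u} :=
  adhesive_of_preserves_and_reflects_isomorphism FintypeCat.incl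

instance {G : Type w} [Group G] : Adhesive (Action FintypeCat.{u} G) :=
  adhesive_of_preserves_and_reflects_isomorphism (Action.forget FintypeCat G)

end OpRegular

section FiniteSets

variable {G : Type w} [Group G]

theorem mono_iff_injective {X Y : FintypeCat.{u}} (f : X ⟶ Y) : Mono f ↔ Function.Injective f :=
  ConcreteCategory.mono_iff_injective_of_preservesPullback f

theorem mono_iff_injective_hom {X Y : Action FintypeCat.{u} G} (f : X ⟶ Y) :
    Mono f ↔ Function.Injective f.hom := by
  rw [← mono_iff_injective]
  exact ⟨fun _ => inferInstanceAs (Mono ((Action.forget _ _).map f)),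
    fun h => (Action.forget _ _).mono_of_mono_map (f := f) h⟩

theorem hom_smul {X Y : Action FintypeCat.{u} G} (f : X ⟶ Y) (g : G) (x : X.V) :
    f.hom (g • x) = g • f.hom x :=
  ConcreteCategory.congr_hom (f.comm g) x

/-- A subset of a finite `G`-set that is stable under `G`, as a finite `G`-set. -/
def subAction (Y : Action FintypeCat.{u} G) (S : Set Y.V) (h : ∀ (g : G), ∀ y ∈ S, g • y ∈ S) :
    Action FintypeCat.{u} G where
  V := FintypeCat.of S
  ρ :=
    { toFun g := FintypeCat.homMk fun y => ⟨g • y.1, h g y.1 y.2⟩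
      map_one' := FintypeCat.hom_ext _ _ fun y => Subtype.ext (one_smul G y.1)
      map_mul' := fun a b => FintypeCat.hom_ext _ _ fun y => Subtype.ext (mul_smul a b y.1) }

/-- The inclusion of a stable subset. -/
def subActionIncl (Y : Action FintypeCat.{u} G) (S : Set Y.V)
    (h : ∀ (g : G), ∀ y ∈ S, g • y ∈ S) : subAction Y S h ⟶ Y where
  hom := FintypeCat.homMk Subtype.val
  comm _ := rfl

instance : RegularCat FintypeCat.{u}ᵒᵖ := regularCat_op fun {X Y} f => by
  refine ⟨FintypeCat.of (Set.range f), FintypeCat.homMk (Set.rangeFactorization f),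
    FintypeCat.homMk Subtype.val, ?_, ?_, rfl⟩
  · exact ConcreteCategory.epi_of_surjective _ Set.rangeFactorization_surjective
  · exact ConcreteCategory.mono_of_injective _ Subtype.val_injective

instance : RegularCat (Action FintypeCat.{u} G)ᵒᵖ := regularCat_op fun {X Y} f => by
  have h (g : G) (y) (hy : y ∈ Set.range f.hom) : g • y ∈ Set.range f.hom := by
    obtain ⟨x, rfl⟩ := hy
    exact ⟨g • x, hom_smul f g x⟩
  refine ⟨subAction Y (Set.range f.hom) h, ⟨FintypeCat.homMk (Set.rangeFactorization f.hom), fun g =>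
    ?_⟩, subActionIncl _ _ _, ?_, ?_, rfl⟩
  · ext x
    exact Subtype.ext (hom_smul f g x)
  · apply (Action.forget _ _).epi_of_epi_map
    exact ConcreteCategory.epi_of_surjective _ Set.rangeFactorization_surjective
  · rw [mono_iff_injective_hom]
    exact Subtype.val_injective

theorem pushout_compl {X Y X' P : FintypeCat.{u}} {f : X ⟶ Y} {g : X ⟶ X'} {h : Y ⟶ P} {k : X' ⟶ P}
    (s : IsPushout f g h k) :
    Set.InjOn h (Set.range f)ᶜ ∧ (Set.range k)ᶜ = h '' (Set.range f)ᶜ := by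
  classical
  let u : Y ⟶ FintypeCat.of (Option Y) :=
    FintypeCat.homMk fun y => if y ∈ Set.range f then none else some y
  let v : X' ⟶ FintypeCat.of (Option Y) := FintypeCat.homMk fun _ => none
  have huv : f ≫ u = g ≫ v := by
    refine FintypeCat.hom_ext _ _ fun x => ?_
    exact if_pos ⟨x, rfl⟩
  have hu (y) : s.desc u v huv (h y) = u y := ConcreteCategory.congr_hom (s.inl_desc u v huv) y
  have hv (x) : s.desc u v huv (k x) = none := ConcreteCategory.congr_hom (s.inr_desc u v huv) x
  have hu' (y) (hy : y ∈ (Set.range f)ᶜ) : s.desc u v huv (h y) = some y := by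
    rw [hu]
    exact if_neg hy
  have hsq (x) : h (f x) = k (g x) := ConcreteCategory.congr_hom s.w x
  have hsurj (p : P) : p ∈ Set.range h ∪ Set.range k := by
    let T : FintypeCat.{u} := FintypeCat.of (ULift.{u} Bool)
    let a : P ⟶ T := FintypeCat.homMk fun _ => ULift.up true
    let b : P ⟶ T := FintypeCat.homMk fun p => ULift.up (decide (p ∈ Set.range h ∪ Set.range k))
    have : a = b := by
      apply s.hom_ext
      · refine FintypeCat.hom_ext _ _ fun y => ?_
        exact congrArg ULift.up (decide_eq_true (Or.inl ⟨y, rfl⟩)).symm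
      · refine FintypeCat.hom_ext _ _ fun y => ?_
        exact congrArg ULift.up (decide_eq_true (Or.inr ⟨y, rfl⟩)).symm
    have := congrArg ULift.down (ConcreteCategory.congr_hom this p)
    exact of_decide_eq_true this.symm
  refine ⟨fun y hy y' hy' e => ?_, ?_⟩
  · have := hu' y hy
    rw [e, hu' y' hy'] at this
    exact (Option.some.inj this).symm
  · ext p
    constructor
    · intro hp
      rcases hsurj p with ⟨y, rfl⟩ | hp'
      · refine ⟨y, ?_, rfl⟩
        rintro ⟨x, rfl⟩
        exact hp ⟨g x, (hsq x).symm⟩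
      · exact absurd hp' hp
    · rintro ⟨y, hy, rfl⟩ ⟨x, hx⟩
      have := hu' y hy
      rw [← hx, hv] at this
      cases this

variable {K : Type v} [Field K]

/-- The degree function on the opposite of the category of finite sets: an injective map
`e : X → Y` has degree `t ^ |Y ∖ e(X)|`. -/
def degSets (t : K) : DegreeFunction FintypeCat.{u}ᵒᵖ K where
  deg {x y} e _ := t ^ (Set.range e.unop)ᶜ.ncard
  deg_id x := by
    have : Set.range (𝟙 x : x ⟶ x).unop = Set.univ := Set.range_eq_univ.2 fun y => ⟨y, rfl⟩
    rw [this, Set.compl_univ, Set.ncard_empty, pow_zero]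
  deg_comp {x y z} e e' _ _ := by
    have he : Function.Injective e.unop := (mono_iff_injective _).1 inferInstance
    have h : (Set.range (e ≫ e').unop)ᶜ =
        (Set.range e.unop)ᶜ ∪ e.unop '' (Set.range e'.unop)ᶜ := by
      ext a
      constructor
      · intro ha
        by_cases h : a ∈ Set.range e.unop
        · obtain ⟨b, rfl⟩ := h
          exact .inr ⟨b, fun ⟨c, hc⟩ => ha ⟨c, congrArg e.unop hc⟩, rfl⟩
        · exact .inl h
      · rintro (ha | ⟨b, hb, rfl⟩) ⟨c, hc⟩
        · exact ha ⟨e'.unop c, hc⟩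
        · exact hb ⟨c, he hc⟩
    rw [h, Set.ncard_union_eq, Set.ncard_image_of_injective _ he, pow_add, mul_comm]
    rw [Set.disjoint_left]
    rintro _ ha ⟨b, _, rfl⟩
    exact ha ⟨b, rfl⟩
  deg_pullback s _ _ := by
    obtain ⟨h₁, h₂⟩ := pushout_compl s.flip.unop
    rw [h₂, h₁.ncard_image]

/-- The nonempty transitive finite `G`-sets. -/
abbrev TransitiveSet (G : Type w) [Group G] :=
  {X : Action FintypeCat.{u} G // Nonempty X.V ∧ MulAction.IsPretransitive G X.V}

/-- Isomorphism of transitive `G`-sets. -/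
def isoSetoid (G : Type w) [Group G] : Setoid (TransitiveSet.{u} G) where
  r X Y := Nonempty (X.1 ≅ Y.1)
  iseqv := ⟨fun _ => ⟨Iso.refl _⟩, fun ⟨e⟩ => ⟨e.symm⟩, fun ⟨e⟩ ⟨e'⟩ => ⟨e.trans e'⟩⟩

/-- The set of isomorphism classes of nonempty transitive finite `G`-sets. -/
def Tran (G : Type w) [Group G] := Quotient (isoSetoid.{u} G)

/-- The isomorphism class of an orbit. -/
def orbitClass (Y : Action FintypeCat.{u} G) (ω : MulAction.orbitRel.Quotient G Y.V) :
    Tran.{u} G :=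
  Quotient.mk _ ⟨subAction Y ω.orbit fun g _ hy => MulAction.orbitRel.Quotient.mapsTo_smul_orbit g ω hy, by
    refine ⟨ω.nonempty_orbit.to_subtype, ⟨?_⟩⟩
    rintro ⟨a, ha⟩ ⟨b, hb⟩
    rw [MulAction.orbitRel.Quotient.mem_orbit] at ha hb
    obtain ⟨g, hg⟩ := MulAction.orbitRel_apply.1 (Quotient.exact (hb.trans ha.symm))
    exact ⟨g, Subtype.ext hg⟩⟩

/-- The orbits of `Y` outside the image of `f : X → Y`. -/
def orbitsOutside {X Y : Action FintypeCat.{u} G} (f : X ⟶ Y) :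
    Set (MulAction.orbitRel.Quotient G Y.V) :=
  {ω | Disjoint ω.orbit (Set.range f.hom)}

/-- The map on orbits induced by a `G`-map. -/
def orbitMap {X Y : Action FintypeCat.{u} G} (f : X ⟶ Y) :
    MulAction.orbitRel.Quotient G X.V → MulAction.orbitRel.Quotient G Y.V :=
  Quotient.map f.hom fun a b h => by
    obtain ⟨g, rfl⟩ := h
    exact ⟨g, (hom_smul f g b).symm⟩

/-- The class of a point in the set of orbits. -/
def orbitMk (Y : Action FintypeCat.{u} G) (y : Y.V) : MulAction.orbitRel.Quotient G Y.V :=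
  Quotient.mk _ y

theorem mem_orbitsOutside {X Y : Action FintypeCat.{u} G} (f : X ⟶ Y) (y : Y.V) :
    orbitMk Y y ∈ orbitsOutside f ↔ y ∈ (Set.range f.hom)ᶜ := by
  constructor
  · intro h hy
    exact Set.disjoint_left.1 h (MulAction.mem_orbit_self y) hy
  · intro h
    refine Set.disjoint_left.2 ?_
    rintro _ ⟨g, rfl⟩ ⟨x, hx⟩
    refine h ⟨g⁻¹ • x, ?_⟩
    rw [hom_smul, hx]
    exact inv_smul_smul g y

theorem orbitMk_eq {Y : Action FintypeCat.{u} G} {y y' : Y.V} :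
    orbitMk Y y = orbitMk Y y' ↔ ∃ g : G, g • y' = y := by
  constructor
  · exact fun h => Quotient.exact h
  · exact fun h => Quotient.sound h

theorem orbitMap_mk {X Y : Action FintypeCat.{u} G} (f : X ⟶ Y) (x : X.V) :
    orbitMap f (orbitMk X x) = orbitMk Y (f.hom x) := rfl

theorem orbitMk_surj {Y : Action FintypeCat.{u} G} (ω : MulAction.orbitRel.Quotient G Y.V) :
    ∃ y, orbitMk Y y = ω := Quotient.exists_rep ω

theorem orbitClass_map {X Y : Action FintypeCat.{u} G} (f : X ⟶ Y)
    (ω : MulAction.orbitRel.Quotient G X.V) (h : Set.InjOn f.hom ω.orbit) :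
    orbitClass Y (orbitMap f ω) = orbitClass X ω := by
  let F : subAction X ω.orbit (fun g _ hy => MulAction.orbitRel.Quotient.mapsTo_smul_orbit g ω hy) ⟶
      subAction Y (orbitMap f ω).orbit
        (fun g _ hy => MulAction.orbitRel.Quotient.mapsTo_smul_orbit g _ hy) :=
    { hom := FintypeCat.homMk fun x => ⟨f.hom x.1,
        MulAction.orbitRel.Quotient.mem_orbit.2
          (congrArg (orbitMap f) (MulAction.orbitRel.Quotient.mem_orbit.1 x.2))⟩
      comm := fun g => FintypeCat.hom_ext _ _ fun x => Subtype.ext (hom_smul f g x.1) }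
  have hF : Function.Bijective F.hom := by
    constructor
    · intro a b e
      exact Subtype.ext (h a.2 b.2 (congrArg Subtype.val e))
    · rintro ⟨y, hy⟩
      obtain ⟨x, rfl⟩ := orbitMk_surj ω
      obtain ⟨g, rfl⟩ := orbitMk_eq.1 (MulAction.orbitRel.Quotient.mem_orbit.1 hy)
      exact ⟨⟨g • x, MulAction.mem_orbit _ _⟩, Subtype.ext (hom_smul f g x)⟩
  have : IsIso ((Action.forget _ _).map F) := (ConcreteCategory.isIso_iff_bijective F.hom).2 hF
  have : IsIso F := isIso_of_reflects_iso F (Action.forget _ _)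
  exact Quotient.sound ⟨(asIso F).symm⟩

theorem smul_mem_compl_range {X Y : Action FintypeCat.{u} G} (f : X ⟶ Y) (g : G) {y : Y.V}
    (hy : y ∈ (Set.range f.hom)ᶜ) : g • y ∈ (Set.range f.hom)ᶜ := by
  rw [← mem_orbitsOutside] at hy ⊢
  rwa [orbitMk_eq.2 ⟨g, rfl⟩]

theorem orbitMap_injOn {X Y P : Action FintypeCat.{u} G} {f : X ⟶ Y} (h : Y ⟶ P)
    (hi : Set.InjOn h.hom (Set.range f.hom)ᶜ) : Set.InjOn (orbitMap h) (orbitsOutside f) := by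
  intro ω hω ω' hω' e
  obtain ⟨y, rfl⟩ := orbitMk_surj ω
  obtain ⟨y', rfl⟩ := orbitMk_surj ω'
  rw [mem_orbitsOutside] at hω hω'
  obtain ⟨g, hg⟩ := orbitMk_eq.1 e
  rw [← hom_smul] at hg
  exact orbitMk_eq.2 ⟨g, hi (smul_mem_compl_range f g hω') hω hg⟩

theorem orbitMap_image {X Y X' P : Action FintypeCat.{u} G} {f : X ⟶ Y} {k : X' ⟶ P}
    (h : Y ⟶ P) (he : (Set.range k.hom)ᶜ = h.hom '' (Set.range f.hom)ᶜ) :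
    orbitsOutside k = orbitMap h '' orbitsOutside f := by
  ext ω
  obtain ⟨p, rfl⟩ := orbitMk_surj ω
  rw [mem_orbitsOutside, he]
  constructor
  · rintro ⟨y, hy, rfl⟩
    exact ⟨orbitMk Y y, (mem_orbitsOutside f y).2 hy, rfl⟩
  · rintro ⟨ω, hω, e⟩
    obtain ⟨y, rfl⟩ := orbitMk_surj ω
    rw [mem_orbitsOutside] at hω
    obtain ⟨g, rfl⟩ := orbitMk_eq.1 e.symm
    exact ⟨g • y, smul_mem_compl_range f g hω, hom_smul h g y⟩

/-- The degree function attached to `φ` on the opposite of the category of finite `G`-sets: an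
injective `G`-map `e : X → Y` has degree `∏ φ(S)`, the product being over the orbits `S` of
`Y ∖ e(X)`. -/
def degGSets (φ : Tran.{u} G → K) : DegreeFunction (Action FintypeCat.{u} G)ᵒᵖ K where
  deg {x y} e _ := ∏ᶠ ω ∈ orbitsOutside e.unop, φ (orbitClass x.unop ω)
  deg_id x := by
    have : orbitsOutside (𝟙 x : x ⟶ x).unop = ∅ := by
      refine Set.eq_empty_iff_forall_notMem.2 fun ω => ?_
      obtain ⟨y, rfl⟩ := orbitMk_surj ω
      rw [mem_orbitsOutside]
      exact fun h => h ⟨y, rfl⟩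
    rw [this, finprod_mem_empty]
  deg_comp {x y z} e e' _ _ := by
    have he : Function.Injective e.unop.hom := (mono_iff_injective_hom _).1 inferInstance
    have h : orbitsOutside (e ≫ e').unop =
        orbitMap e.unop '' orbitsOutside e'.unop ∪ orbitsOutside e.unop := by
      ext ω
      obtain ⟨a, rfl⟩ := orbitMk_surj ω
      rw [Set.mem_union, mem_orbitsOutside, mem_orbitsOutside]
      constructor
      · intro ha
        by_cases h : a ∈ Set.range e.unop.hom
        · obtain ⟨b, rfl⟩ := h
          refine .inl ⟨orbitMk _ b, ?_, rfl⟩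
          rw [mem_orbitsOutside]
          exact fun ⟨c, hc⟩ => ha ⟨c, congrArg e.unop.hom hc⟩
        · exact .inr h
      · rintro (⟨ω, hω, h⟩ | ha) ⟨c, hc⟩
        · obtain ⟨b, rfl⟩ := orbitMk_surj ω
          rw [mem_orbitsOutside] at hω
          rw [orbitMap_mk, orbitMk_eq] at h
          obtain ⟨g, hg⟩ := h
          refine hω ⟨g • c, he ?_⟩
          rw [hom_smul, hom_smul, ← hg]
          exact congrArg (g • ·) hc
        · exact ha ⟨e'.unop.hom c, hc⟩
    have hd : Disjoint (orbitMap e.unop '' orbitsOutside e'.unop) (orbitsOutside e.unop) := by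
      rw [Set.disjoint_left]
      rintro _ ⟨ω, _, rfl⟩ h
      obtain ⟨b, rfl⟩ := orbitMk_surj ω
      rw [orbitMap_mk, mem_orbitsOutside] at h
      exact h ⟨b, rfl⟩
    rw [h, finprod_mem_union hd (Set.toFinite _) (Set.toFinite _), finprod_mem_image]
    · congr 1
      refine finprod_mem_congr rfl fun ω _ => ?_
      rw [orbitClass_map _ _ he.injOn]
    · exact orbitMap_injOn _ he.injOn
  deg_pullback {p x y z fst snd f g} s _ _ := by
    obtain ⟨h₁, h₂⟩ := pushout_compl (s.flip.unop.map (Action.forget _ _))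
    rw [orbitMap_image fst.unop h₂, finprod_mem_image (orbitMap_injOn _ h₁)]
    refine finprod_mem_congr rfl fun ω hω => ?_
    rw [orbitClass_map]
    refine h₁.mono ?_
    exact fun y hy hy' => Set.disjoint_left.1 hω hy hy'

/-- The functor endowing a finite set with the trivial action. -/
def triv (G : Type w) [Group G] : FintypeCat.{u} ⥤ Action FintypeCat.{u} G where
  obj X := ⟨X, 1⟩
  map f := ⟨f, fun _ => by simp⟩

/-- The functor of orbits. -/
def orb (G : Type w) [Group G] : Action FintypeCat.{u} G ⥤ FintypeCat.{u} where
  obj X := FintypeCat.of (MulAction.orbitRel.Quotient G X.V)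
  map f := FintypeCat.homMk (orbitMap f)
  map_id X := FintypeCat.hom_ext _ _ fun ω => by
    obtain ⟨x, rfl⟩ := orbitMk_surj ω
    rfl
  map_comp f g := FintypeCat.hom_ext _ _ fun ω => by
    obtain ⟨x, rfl⟩ := orbitMk_surj ω
    rfl

/-- Orbits are left adjoint to the trivial action. -/
def orbTriv (G : Type w) [Group G] : orb.{u} G ⊣ triv G :=
  Adjunction.mkOfUnitCounit
    { unit :=
        { app X := ⟨FintypeCat.homMk (orbitMk X), fun g => FintypeCat.hom_ext _ _ fun x =>
            orbitMk_eq.2 ⟨g, rfl⟩⟩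
          naturality _ _ f := by
            apply Action.Hom.ext
            rfl }
      counit :=
        { app X := FintypeCat.homMk (Quotient.lift id fun a b ⟨_, h⟩ => h.symm)
          naturality _ _ f := FintypeCat.hom_ext _ _ fun ω => by
            obtain ⟨x, rfl⟩ := orbitMk_surj ω
            rfl }
      left_triangle := by
        apply NatTrans.ext
        funext X
        refine FintypeCat.hom_ext _ _ fun ω => ?_
        obtain ⟨x, rfl⟩ := orbitMk_surj ω
        rfl
      right_triangle := by
        apply NatTrans.ext
        funext X
        apply Action.Hom.ext
        rfl }

/-- The trivial action functor on the opposite categories. -/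
abbrev trivOp (G : Type w) [Group G] : FintypeCat.{u}ᵒᵖ ⥤ (Action FintypeCat.{u} G)ᵒᵖ := (triv G).op

/-- The orbit functor on the opposite categories. -/
abbrev orbOp (G : Type w) [Group G] : (Action FintypeCat.{u} G)ᵒᵖ ⥤ FintypeCat.{u}ᵒᵖ := (orb G).op

/-- On the opposite categories, the trivial action functor is left adjoint to the orbit
functor. -/
def adjTrivOrb (G : Type w) [Group G] : trivOp G ⊣ orbOp G := (orbTriv G).op

end FiniteSets

end Knop

end

/-!
The statement is an instance of two facts about regular categories with degree functions.

*Existence of induced functors.* Let `F : A ⥤ A'` preserve finite limits and degrees. Every span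
`x ⟵ a ⟶ y` has a weighted image `spanRel δ f g`, which is the degree of `a ⟶ im a` times the basis
element of the image; these weighted images span the linear combinations of relations, and they
compose by fibre products, without any further factor. As `F` preserves epimorphisms and their
degrees, `⟨r⟩ ↦ ⟨F r⟩` sends the weighted image of a span to that of the image span
(`pushRel_span`). As `F` preserves fibre products, it is functorial (`pushRel_comp`), and as `F`
preserves products, the graphs of the comparison morphisms `F (x ⨯ y) ⟶ F x ⨯ F y` and `F ⊤ ⟶ ⊤`
make it symmetric monoidal (`T0.mapOplax`, `T0.mapBraided`). Any linear symmetric monoidal functor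
extends to matrices entrywise and then to direct summands (`mapMatBraided`, `mapKarBraided`), which
gives `inducedFunctor`.

*The composite of induced functors.* Let `η : 𝟭 ≅ S T` be an isomorphism. The graph of `η`
intertwines `⟨r⟩` with `⟨S T r⟩` (`rel_comp_graph_unit`), hence `Γ η`, transported along the
identifications `Sbar (Tbar [x]) ≅ [S T x]`, is natural on the full subcategory of the objects
`[x]`. Every object `Q` of the completion has finitely many maps `pᵢ : Q ⟶ [xᵢ]` and `qᵢ : [xᵢ] ⟶ Q`
with `∑ pᵢ ≫ qᵢ = 𝟙`, so a transformation `α` on this subcategory between additive functors `F` and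
`G` extends uniquely, by `∑ F pᵢ ≫ α ≫ G qᵢ` (`extendNatIso`).

It remains to look at finite sets. The trivial action functor preserves finite colimits because they
are computed on underlying sets, the orbit functor because it is a left adjoint. The orbits outside
the image of an equivariant map are the points outside the image of the induced map on orbits; for
trivial actions, they correspond to the points outside the image of the map itself. This gives the
equalities of degrees. Finally, `η` is invertible because the trivial action functor is fully
faithful.
-/

noncomputable section

namespace Knop

/-! ### The functor induced on linear combinations of relations -/

section MapRelations

attribute [local simp] prod.lift_fst prod.lift_snd prod.lift_fst_assoc prod.lift_snd_assoc

theorem mono_lift_map {A : Type u} [Category.{v} A] [RegularCat A] {A' : Type u'}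
    [Category.{v'} A'] (F : A ⥤ A') [PreservesFiniteLimits F] {a x y : A} (f : a ⟶ x) (g : a ⟶ y)
    [Mono (prod.lift f g)] : Mono (prod.lift (F.map f) (F.map g)) := by
  have h : prod.lift (F.map f) (F.map g) = F.map (prod.lift f g) ≫ prodComparison F x y := by
    apply Limits.prod.hom_ext
    · rw [prod.lift_fst, Category.assoc, prodComparison_fst, ← F.map_comp, prod.lift_fst]
    · rw [prod.lift_snd, Category.assoc, prodComparison_snd, ← F.map_comp, prod.lift_snd]
  rw [h]
  infer_instance

variable {A : Type u} [Category.{v} A] [RegularCat A] {A' : Type u'} [Category.{v'} A']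
  [RegularCat A'] {K : Type w} [Field K] (F : A ⥤ A')

variable (K) in
/-- The linear extension of `r ↦ F r` to formal linear combinations of relations. -/
def pushRel (x y : A) : LRel K x y →ₗ[K] LRel K (F.obj x) (F.obj y) :=
  Finsupp.lmapDomain K K (mapRel F)

theorem pushRel_single {x y : A} (r : Rel x y) (c : K) :
    pushRel K F x y (Finsupp.single r c) = Finsupp.single (mapRel F r) c :=
  Finsupp.mapDomain_single

variable {δ : DegreeFunction A K} {δ' : DegreeFunction A' K}

theorem single_mapRel [PreservesFiniteLimits F] (δ' : DegreeFunction A' K) {x y : A}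
    (r : Rel x y) :
    (Finsupp.single (mapRel F r) 1 : LRel K (F.obj x) (F.obj y)) =
      spanRel δ' (F.map r.p) (F.map r.q) := by
  have : Mono (prod.lift r.p r.q) := by rw [r.lift_p_q]; infer_instance
  have := mono_lift_map F r.p r.q
  rw [spanRel_mk, mapRel, imageSubobject_mono]

variable {F}

/-- A degree-preserving functor sends the weighted image of a span to the weighted image of the
image span. -/
theorem pushRel_span [PreservesFiniteLimits F] (h : PreservesDegree F δ δ') {a x y : A}
    (f : a ⟶ x) (g : a ⟶ y) :
    pushRel K F x y (spanRel δ f g) = spanRel δ' (F.map f) (F.map g) := by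
  obtain ⟨r, e, _, rfl, rfl⟩ := spanRel_eq_smul f g
  obtain ⟨_, he⟩ := h e
  rw [spanRel_comp, spanRel_rel, map_smul, pushRel_single, single_mapRel F δ', F.map_comp,
    F.map_comp, spanRel_comp, he]

theorem pushRel_graph [PreservesFiniteLimits F] (h : PreservesDegree F δ δ') {x y : A}
    (f : x ⟶ y) : pushRel K F x y (graph K f) = graph K (F.map f) := by
  rw [graph_eq δ, pushRel_span h, F.map_id, ← graph_eq]

theorem pushRel_comp [PreservesFiniteLimits F] (h : PreservesDegree F δ δ') {x y z : A}
    (f : LRel K x y) (g : LRel K y z) :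
    pushRel K F x z (comp δ x y z f g) =
      comp δ' _ _ _ (pushRel K F x y f) (pushRel K F y z g) := by
  induction f using span_ind δ with
  | zero => simp
  | add f g hf hg => simp only [map_add, LinearMap.add_apply, hf, hg]
  | smul c f hf => simp only [map_smul, LinearMap.smul_apply, hf]
  | span f₁ f₂ =>
  induction g using span_ind δ with
  | zero => simp
  | add f g hf hg => simp only [map_add, hf, hg]
  | smul c f hf => simp only [map_smul, hf]
  | span g₁ g₂ =>
  have s := IsPullback.of_hasPullback f₂ g₁
  rw [comp_span δ s, pushRel_span h, pushRel_span h, pushRel_span h, comp_span δ' (s.map F),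
    F.map_comp, F.map_comp]

/-- The comparison morphisms `F (x ⨯ y) ⟶ F x ⨯ F y` are natural for linear combinations of
relations, not only for morphisms. -/
theorem pushRel_tensor [PreservesFiniteLimits F] (h : PreservesDegree F δ δ') {x y x' y' : A}
    (f : LRel K x y) (f' : LRel K x' y') :
    comp δ' _ _ _ (graph K (prodComparison F x x'))
      (tensor K _ _ _ _ (pushRel K F x y f) (pushRel K F x' y' f')) =
    comp δ' _ _ _ (pushRel K F _ _ (tensor K _ _ _ _ f f')) (graph K (prodComparison F y y')) := by
  induction f using span_ind δ with
  | zero => simp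
  | add f g hf hg => simp only [map_add, LinearMap.add_apply, hf, hg]
  | smul c f hf => simp only [map_smul, LinearMap.smul_apply, hf]
  | @span a f₁ f₂ =>
  induction f' using span_ind δ with
  | zero => simp
  | add f g hf hg => simp only [map_add, LinearMap.add_apply, hf, hg]
  | smul c f hf => simp only [map_smul, LinearMap.smul_apply, hf]
  | @span b f₁' f₂' =>
  rw [tensor_span, pushRel_span h, pushRel_span h, pushRel_span h, tensor_span, iso_comp_span,
    span_comp_graph, prodComparison_natural, ← spanRel_iso δ' (prodComparison F a b) (_ ≫ _),
    ← prodComparison_natural_assoc, IsIso.hom_inv_id, Category.comp_id]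

theorem prodComparison_assoc (h : PreservesDegree F δ δ') [PreservesFiniteLimits F] (x y z : A) :
    comp δ' _ _ _ (graph K (prodComparison F (x ⨯ y) z))
      (comp δ' _ _ _ (tensor K _ _ _ _ (graph K (prodComparison F x y)) (graph K (𝟙 (F.obj z))))
        (graph K (prod.associator (F.obj x) (F.obj y) (F.obj z)).hom)) =
    comp δ' _ _ _ (pushRel K F _ _ (graph K (prod.associator x y z).hom))
      (comp δ' _ _ _ (graph K (prodComparison F x (y ⨯ z)))
        (tensor K _ _ _ _ (graph K (𝟙 (F.obj x))) (graph K (prodComparison F y z)))) := by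
  simp only [pushRel_graph h, tensor_graph _ _ δ', graph_comp_graph]
  congr 1
  ext <;> simp [prodComparison, ← F.map_comp, -Functor.map_comp]

theorem prodComparison_leftUnitor (h : PreservesDegree F δ δ') [PreservesFiniteLimits F] (x : A) :
    graph K (prod.leftUnitor (F.obj x)).inv =
      comp δ' _ _ _ (pushRel K F _ _ (graph K (prod.leftUnitor x).inv))
        (comp δ' _ _ _ (graph K (prodComparison F (⊤_ A) x))
          (tensor K _ _ _ _ (graph K (terminal.from (F.obj (⊤_ A)))) (graph K (𝟙 (F.obj x))))) := by
  simp only [pushRel_graph h, tensor_graph _ _ δ', graph_comp_graph]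
  congr 1
  ext
  simp [prodComparison, ← F.map_comp, -Functor.map_comp]

theorem prodComparison_rightUnitor (h : PreservesDegree F δ δ') [PreservesFiniteLimits F] (x : A) :
    graph K (prod.rightUnitor (F.obj x)).inv =
      comp δ' _ _ _ (pushRel K F _ _ (graph K (prod.rightUnitor x).inv))
        (comp δ' _ _ _ (graph K (prodComparison F x (⊤_ A)))
          (tensor K _ _ _ _ (graph K (𝟙 (F.obj x))) (graph K (terminal.from (F.obj (⊤_ A)))))) := by
  simp only [pushRel_graph h, tensor_graph _ _ δ', graph_comp_graph]
  congr 1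
  ext
  simp [prodComparison, ← F.map_comp, -Functor.map_comp]

theorem prodComparison_braiding (h : PreservesDegree F δ δ') [PreservesFiniteLimits F] (x y : A) :
    comp δ' _ _ _ (pushRel K F _ _ (graph K (prod.braiding x y).hom))
      (graph K (prodComparison F y x)) =
    comp δ' _ _ _ (graph K (prodComparison F x y))
      (graph K (prod.braiding (F.obj x) (F.obj y)).hom) := by
  simp only [pushRel_graph h, graph_comp_graph]
  congr 1
  ext <;> simp [prodComparison, ← F.map_comp, -Functor.map_comp]

end MapRelations

namespace T0

variable {A : Type u} [Category.{v} A] [RegularCat A] {A' : Type u'} [Category.{v'} A']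
  [RegularCat A'] {K : Type w} [Field K] {F : A ⥤ A'} [PreservesFiniteLimits F]
  {δ : DegreeFunction A K} {δ' : DegreeFunction A' K}

/-- The functor `[x] ↦ [F x]`, `⟨r⟩ ↦ ⟨F r⟩` induced by a functor that preserves finite limits and
degrees. -/
def map (h : PreservesDegree F δ δ') : T0 δ ⥤ T0 δ' where
  obj X := ⟨F.obj X.obj⟩
  map {X Y} f := pushRel K F X.obj Y.obj f
  map_id X := (pushRel_graph h (𝟙 X.obj)).trans (by rw [F.map_id]; rfl)
  map_comp f g := pushRel_comp h f g

variable (h : PreservesDegree F δ δ')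

instance : (map h).Additive where
  map_add {X Y} f g := map_add (pushRel K F X.obj Y.obj) f g

instance : (map h).Linear K where
  map_smul {X Y} f c := map_smul (pushRel K F X.obj Y.obj) c f

/-- The comparison morphisms `F (x × y) → F x × F y` and `F ⊤ → ⊤` make the induced functor
oplax monoidal. -/
@[reducible]
def mapOplax : (map h).OplaxMonoidal where
  η := (Γ δ').map (terminal.from (F.obj (⊤_ A)))
  δ X Y := (Γ δ').map (prodComparison F X.obj Y.obj)
  δ_natural_left {X Y} f Z := by
    have := pushRel_tensor h (show LRel K X.obj Y.obj from f) (graph K (𝟙 Z.obj))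
    rw [pushRel_graph h, F.map_id] at this
    exact this
  δ_natural_right {X Y} Z f := by
    have := pushRel_tensor h (graph K (𝟙 Z.obj)) (show LRel K X.obj Y.obj from f)
    rw [pushRel_graph h, F.map_id] at this
    exact this
  oplax_associativity X Y Z := prodComparison_assoc h X.obj Y.obj Z.obj
  oplax_left_unitality X := prodComparison_leftUnitor h X.obj
  oplax_right_unitality X := prodComparison_rightUnitor h X.obj

instance mapMonoidal : (map h).Monoidal :=
  letI := mapOplax h
  have : IsIso (terminal.from (F.obj (⊤_ A))) := inferInstanceAs (IsIso (terminalComparison F))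
  have : IsIso (Functor.OplaxMonoidal.η (map h)) :=
    inferInstanceAs (IsIso ((Γ δ').map (terminal.from (F.obj (⊤_ A)))))
  have (X Y : T0 δ) : IsIso (Functor.OplaxMonoidal.δ (map h) X Y) :=
    inferInstanceAs (IsIso ((Γ δ').map (prodComparison F X.obj Y.obj)))
  Functor.Monoidal.ofOplaxMonoidal (map h)

instance mapBraided : (map h).Braided where
  braided X Y := by
    rw [← cancel_epi (Functor.OplaxMonoidal.δ (map h) X Y), Functor.Monoidal.δ_μ_assoc,
      ← cancel_mono (Functor.OplaxMonoidal.δ (map h) Y X), Category.assoc, Category.assoc,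
      Functor.Monoidal.μ_δ, Category.comp_id]
    exact prodComparison_braiding h X.obj Y.obj

end T0

/-! ### Monoidal functors between categories of matrices and Karoubi envelopes -/

section MapMat

open Functor.LaxMonoidal Functor.OplaxMonoidal

variable {C : Type u} [Category.{v} C] [Preadditive C] {D : Type u'} [Category.{v'} D]
  [Preadditive D] (F : C ⥤ D) [F.Additive]

/-- The functor induced between categories of matrices. In contrast to `Functor.mapMat_`, the
morphisms of the two categories may lie in different universes. It is reducible, so that the index
type and the entries of `(mapMat F).obj M` are recognized as those of `M`. -/
@[reducible]
def mapMat : Mat_ C ⥤ Mat_ D where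
  obj M := ⟨M.ι, fun i => F.obj (M.X i)⟩
  map f := fun i j => F.map (f i j)
  map_id M := by
    ext (i : M.ι) (j : M.ι)
    by_cases h : i = j
    · subst h
      exact ((congrArg F.map (Mat_.id_apply_self M i)).trans (F.map_id _)).trans
        (Mat_.id_apply_self (⟨M.ι, fun i => F.obj (M.X i)⟩ : Mat_ D) i).symm
    · exact ((congrArg F.map (Mat_.id_apply_of_ne M i j h)).trans (F.map_zero _ _)).trans
        (Mat_.id_apply_of_ne (⟨M.ι, fun i => F.obj (M.X i)⟩ : Mat_ D) i j h).symm
  map_comp {M N P} f g := by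
    ext (i : M.ι) (k : P.ι)
    exact ((congrArg F.map (Mat_.comp_apply f g i k)).trans (F.map_sum _ _)).trans
      (Finset.sum_congr rfl fun j _ => F.map_comp (f i j) (g j k))

theorem mapMat_monomial {M N : Mat_ C} (e : M.ι → N.ι) (φ : ∀ i, M.X i ⟶ N.X (e i)) :
    (mapMat F).map (monomial e φ) =
      monomial (M := (mapMat F).obj M) (N := (mapMat F).obj N) e (fun i => F.map (φ i)) := by
  ext (i : M.ι) (j : N.ι)
  change F.map (monomial e φ i j) = _
  by_cases h : e i = j
  · subst h
    rw [monomial_self]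
    exact (monomial_self (M := (mapMat F).obj M) (N := (mapMat F).obj N) e
      (fun i => F.map (φ i)) i).symm
  · rw [monomial_ne e φ h, F.map_zero]
    exact (monomial_ne (M := (mapMat F).obj M) (N := (mapMat F).obj N) e _ h).symm

instance mapMat_additive : (mapMat F).Additive where
  map_add {_ _ f g} := by ext i j; exact F.map_add (f := f i j) (g := g i j)

instance mapMat_linear (K : Type w) [Field K] [Linear K C] [Linear K D] [F.Linear K] :
    (mapMat F).Linear K where
  map_smul f c := by ext i j; exact F.map_smul c (f i j)

variable [MonoidalCategory C] [MonoidalCategory D]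

/-- The entrywise tensorator of the functor induced between categories of matrices. -/
def mapMatμ [F.Monoidal] (M N : Mat_ C) :
    (mapMat F).obj M ⊗ (mapMat F).obj N ≅ (mapMat F).obj (M ⊗ N) :=
  reindexIso (M := (mapMat F).obj M ⊗ (mapMat F).obj N) (N := (mapMat F).obj (M ⊗ N))
    (fun i => i) (fun i => i) (fun i => μ F (M.X i.1) (N.X i.2))
    (fun i => Functor.OplaxMonoidal.δ F (M.X i.1) (N.X i.2))
    (monomial_eq_id _ fun i => Functor.Monoidal.μ_δ F (M.X i.1) (N.X i.2))
    (monomial_eq_id _ fun i => Functor.Monoidal.δ_μ F (M.X i.1) (N.X i.2))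

/-- The unit isomorphism of the functor induced between categories of matrices. -/
def mapMatε [F.Monoidal] : 𝟙_ (Mat_ D) ≅ (mapMat F).obj (𝟙_ (Mat_ C)) :=
  reindexIso (M := 𝟙_ (Mat_ D)) (N := (mapMat F).obj (𝟙_ (Mat_ C)))
    (fun i => i) (fun i => i) (fun _ => ε F) (fun _ => η F)
    (monomial_eq_id _ fun _ => Functor.Monoidal.ε_η F)
    (monomial_eq_id _ fun _ => Functor.Monoidal.η_ε F)

theorem mapMatμ_natural [F.Monoidal] {M N M' N' : Mat_ C} (f : M ⟶ N) (f' : M' ⟶ N') :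
    ((mapMat F).map f ⊗ₘ (mapMat F).map f') ≫ (mapMatμ F N N').hom =
      (mapMatμ F M M').hom ≫ (mapMat F).map (f ⊗ₘ f') := by
  ext ⟨i, i'⟩ ⟨k, k'⟩
  refine (comp_monomial (N := (mapMat F).obj N ⊗ (mapMat F).obj N') (P := (mapMat F).obj (N ⊗ N'))
    (fun i => i) Function.injective_id _ _ _ (k, k')).trans
    (Eq.trans ?_ (monomial_comp _ _ _ _ _).symm)
  exact μ_natural F _ _

variable [MonoidalPreadditive C] [MonoidalPreadditive D]

instance mapMatMonoidal [F.Monoidal] : (mapMat F).Monoidal := Functor.CoreMonoidal.toMonoidal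
  { εIso := mapMatε F
    μIso := mapMatμ F
    μIso_hom_natural_left := fun {X Y} f Z => by
      have := mapMatμ_natural F f (𝟙 Z)
      rwa [(mapMat F).map_id, tensorHom_id, tensorHom_id] at this
    μIso_hom_natural_right := fun {X Y} Z f => by
      have := mapMatμ_natural F (𝟙 Z) f
      rwa [(mapMat F).map_id, id_tensorHom, id_tensorHom] at this
    associativity := fun X Y Z => by
      rw [← tensorHom_id, ← id_tensorHom, ← monomial_id ((mapMat F).obj Z),
        ← monomial_id ((mapMat F).obj X)]
      change (monomial _ _ ⊗ₘ _) ≫ monomial _ _ ≫ (mapMat F).map (monomial _ _) =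
        monomial _ _ ≫ (_ ⊗ₘ monomial _ _) ≫ monomial _ _
      rw [mapMat_monomial, monomial_tensor, monomial_tensor]
      refine (congrArg _ (monomial_comp_monomial _ _ _ _)).trans ?_
      refine (monomial_comp_monomial _ _ _ _).trans ?_
      refine Eq.trans ?_ (congrArg _ (monomial_comp_monomial _ _ _ _).symm)
      refine Eq.trans ?_ (monomial_comp_monomial _ _ _ _).symm
      congr 1
      funext i
      rw [tensorHom_id, id_tensorHom]
      exact associativity F _ _ _
    left_unitality := fun X => by
      rw [← tensorHom_id, ← monomial_id ((mapMat F).obj X)]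
      change monomial _ _ = (monomial _ _ ⊗ₘ _) ≫ monomial _ _ ≫ (mapMat F).map (monomial _ _)
      rw [mapMat_monomial, monomial_tensor]
      refine Eq.trans ?_ (congrArg _ (monomial_comp_monomial _ _ _ _).symm)
      refine Eq.trans ?_ (monomial_comp_monomial _ _ _ _).symm
      congr 1
      funext i
      rw [tensorHom_id]
      exact left_unitality F _
    right_unitality := fun X => by
      rw [← id_tensorHom, ← monomial_id ((mapMat F).obj X)]
      change monomial _ _ = (_ ⊗ₘ monomial _ _) ≫ monomial _ _ ≫ (mapMat F).map (monomial _ _)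
      rw [mapMat_monomial, monomial_tensor]
      refine Eq.trans ?_ (congrArg _ (monomial_comp_monomial _ _ _ _).symm)
      refine Eq.trans ?_ (monomial_comp_monomial _ _ _ _).symm
      congr 1
      funext i
      rw [id_tensorHom]
      exact right_unitality F _ }

end MapMat

section MapMatBraided

open Functor.LaxMonoidal

variable {C : Type u} [Category.{v} C] [Preadditive C] {D : Type u'} [Category.{v'} D]
  [Preadditive D] (F : C ⥤ D) [F.Additive]
  [MonoidalCategory C] [MonoidalCategory D] [MonoidalPreadditive C] [MonoidalPreadditive D]
  [SymmetricCategory C] [SymmetricCategory D]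

instance mapMatBraided [F.Braided] : (mapMat F).Braided where
  braided M N := by
    change monomial _ _ ≫ (mapMat F).map (monomial _ _) = monomial _ _ ≫ monomial _ _
    rw [mapMat_monomial]
    refine (monomial_comp_monomial _ _ _ _).trans ?_
    refine Eq.trans ?_ (monomial_comp_monomial _ _ _ _).symm
    congr 1
    funext i
    exact Functor.LaxBraided.braided _ _

end MapMatBraided

section MapKaroubi

open Functor.LaxMonoidal Functor.OplaxMonoidal Idempotents

variable {C : Type u} [Category.{v} C] {D : Type u'} [Category.{v'} D] (F : C ⥤ D)

/-- The functor induced between Karoubi envelopes, reducible so that the underlying object and the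
idempotent of `(mapKar F).obj P` are recognized as the images of those of `P`. -/
@[reducible]
def mapKar : Karoubi C ⥤ Karoubi D where
  obj P := ⟨F.obj P.X, F.map P.p, by rw [← F.map_comp, P.idem]⟩
  map f := ⟨F.map f.f, by
    change F.map _ ≫ F.map _ ≫ F.map _ = _
    rw [← F.map_comp, ← F.map_comp, f.comm]⟩

theorem mapKar_karHom {P Q : Karoubi C} (f : P.X ⟶ Q.X) (h : P.p ≫ f = f ≫ Q.p) :
    (mapKar F).map (karHom f h) = karHom (P := (mapKar F).obj P) (Q := (mapKar F).obj Q) (F.map f)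
      (by rw [← F.map_comp, h, F.map_comp]) := by
  ext
  exact F.map_comp P.p f

section Additive

variable [Preadditive C] [Preadditive D] [F.Additive]

instance mapKar_additive : (mapKar F).Additive where
  map_add {_ _ f g} := by ext; exact F.map_add (f := f.f) (g := g.f)

instance mapKar_linear (K : Type w) [Field K] [Linear K C] [Linear K D] [F.Linear K] :
    (mapKar F).Linear K where
  map_smul f c := by ext; exact F.map_smul c f.f

end Additive

variable [MonoidalCategory C] [MonoidalCategory D]

/-- The tensorator of the functor induced between Karoubi envelopes. -/
def mapKarμ [F.Monoidal] (P Q : Karoubi C) :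
    (mapKar F).obj P ⊗ (mapKar F).obj Q ≅ (mapKar F).obj (P ⊗ Q) :=
  karIso (P := (mapKar F).obj P ⊗ (mapKar F).obj Q) (Q := (mapKar F).obj (P ⊗ Q))
    (Functor.Monoidal.μIso F P.X Q.X) (μ_natural F P.p Q.p)

/-- The unit isomorphism of the functor induced between Karoubi envelopes. -/
def mapKarε [F.Monoidal] : 𝟙_ (Karoubi D) ≅ (mapKar F).obj (𝟙_ (Karoubi C)) :=
  karIso (P := 𝟙_ (Karoubi D)) (Q := (mapKar F).obj (𝟙_ (Karoubi C))) (Functor.Monoidal.εIso F)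
    (show 𝟙 _ ≫ _ = _ ≫ F.map (𝟙 _) by simp)

theorem mapKarμ_hom [F.Monoidal] (P Q : Karoubi C) : (mapKarμ F P Q).hom =
    karHom (P := (mapKar F).obj P ⊗ (mapKar F).obj Q) (Q := (mapKar F).obj (P ⊗ Q))
      (μ F P.X Q.X) (μ_natural F P.p Q.p) := rfl

theorem mapKarε_hom [F.Monoidal] : (mapKarε F).hom =
    karHom (P := 𝟙_ (Karoubi D)) (Q := (mapKar F).obj (𝟙_ (Karoubi C))) (ε F)
    (show 𝟙 _ ≫ _ = _ ≫ F.map (𝟙 _) by simp) := rfl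

instance mapKarMonoidal [F.Monoidal] : (mapKar F).Monoidal := Functor.CoreMonoidal.toMonoidal
  { εIso := mapKarε F
    μIso := mapKarμ F
    μIso_hom_natural_left := fun {X Y} f Z => kar_natural ((mapKar F).map f ▷ (mapKar F).obj Z)
      ((mapKar F).map (f ▷ Z)) _ (μ_natural F X.p Z.p) _ (μ_natural F Y.p Z.p)
      (μ_natural F f.f Z.p)
    μIso_hom_natural_right := fun {X Y} Z f => kar_natural ((mapKar F).obj Z ◁ (mapKar F).map f)
      ((mapKar F).map (Z ◁ f)) _ (μ_natural F Z.p X.p) _ (μ_natural F Z.p Y.p)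
      (μ_natural F Z.p f.f)
    associativity := fun X Y Z => by
      rw [← tensorHom_id, ← id_tensorHom, ← karHom_id ((mapKar F).obj X),
        ← karHom_id ((mapKar F).obj Z)]
      rw [kar_associator X Y Z, mapKar_karHom]
      simp only [kar_associator, mapKarμ_hom]
      rw [karHom_tensor, karHom_tensor, karHom_comp, karHom_comp, karHom_comp, karHom_comp]
      refine karHom_congr ?_
      rw [tensorHom_id, id_tensorHom]
      exact associativity F _ _ _
    left_unitality := fun X => by
      rw [← tensorHom_id, ← karHom_id ((mapKar F).obj X)]
      rw [kar_leftUnitor X, mapKar_karHom]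
      simp only [kar_leftUnitor, mapKarμ_hom, mapKarε_hom]
      rw [karHom_tensor, karHom_comp, karHom_comp]
      refine karHom_congr ?_
      rw [tensorHom_id]
      exact left_unitality F _
    right_unitality := fun X => by
      rw [← id_tensorHom, ← karHom_id ((mapKar F).obj X)]
      rw [kar_rightUnitor X, mapKar_karHom]
      simp only [kar_rightUnitor, mapKarμ_hom, mapKarε_hom]
      rw [karHom_tensor, karHom_comp, karHom_comp]
      refine karHom_congr ?_
      rw [id_tensorHom]
      exact right_unitality F _ }

instance mapKarBraided [SymmetricCategory C] [SymmetricCategory D] [F.Braided] :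
    (mapKar F).Braided where
  braided P Q := by
    change (mapKarμ F P Q).hom ≫ (mapKar F).map (karBraiding P Q).hom =
      (karBraiding ((mapKar F).obj P) ((mapKar F).obj Q)).hom ≫ (mapKarμ F Q P).hom
    rw [karBraiding_hom P Q, mapKar_karHom]
    simp only [karBraiding_hom, mapKarμ_hom]
    rw [karHom_comp, karHom_comp]
    exact karHom_congr (Functor.LaxBraided.braided P.X Q.X)

end MapKaroubi

/-! ### Existence of induced functors -/

section Completion

open Idempotents

variable {C : Type u} [Category.{v} C] [Preadditive C]

/-- The formal direct sum with the single summand `X`, in unfolded form. -/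
abbrev matOf (X : C) : Mat_ C := ⟨PUnit, fun _ => X⟩

/-- The object of the additive Karoubi completion given by `X`, in unfolded form. -/
abbrev karOf (X : C) : Karoubi (Mat_ C) := ⟨matOf X, 𝟙 _, Category.id_comp _⟩

theorem karOf_comm {X Y : C} (f : matOf X ⟶ matOf Y) :
    (karOf X).p ≫ f = f ≫ (karOf Y).p :=
  (Category.id_comp f).trans (Category.comp_id f).symm

/-- A morphism of `C`, as a morphism of the additive Karoubi completion, written as a monomial
matrix so that composites and tensor products can be computed entrywise. -/
def karOfHom {X Y : C} (f : X ⟶ Y) : karOf X ⟶ karOf Y :=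
  karHom (monomial (M := matOf X) (N := matOf Y) (fun i => i) (fun _ => f)) (karOf_comm _)

theorem karOfHom_eq {X Y : C} (f : X ⟶ Y) :
    (Mat_.embedding C ⋙ toKaroubi (Mat_ C)).map f = karOfHom f := by
  apply Karoubi.hom_ext
  refine Eq.trans ?_ (Category.id_comp (X := matOf X) (Y := matOf Y) _).symm
  funext i j
  exact (monomial_self (M := matOf X) (N := matOf Y) (fun i => i) (fun _ => f) i).symm

section Tensor

variable [MonoidalCategory C] [MonoidalPreadditive C]

theorem karOf_tensor_comm (X Y : C) (f : matOf X ⊗ matOf Y ⟶ matOf (X ⊗ Y)) :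
    (karOf X ⊗ karOf Y).p ≫ f = f ≫ (karOf (X ⊗ Y)).p := by
  change (𝟙 (matOf X) ⊗ₘ 𝟙 (matOf Y)) ≫ f = f ≫ 𝟙 _
  rw [id_tensorHom_id, Category.id_comp, Category.comp_id]

theorem karOf_unit_comm (f : 𝟙_ (Mat_ C) ⟶ matOf (𝟙_ C)) :
    (𝟙_ (Karoubi (Mat_ C))).p ≫ f = f ≫ (karOf (𝟙_ C)).p := by
  change 𝟙 _ ≫ f = f ≫ 𝟙 _
  rw [Category.id_comp, Category.comp_id]

/-- The tensorator of the embedding into the additive Karoubi completion. -/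
def karOfTensor (X Y : C) : karOf X ⊗ karOf Y ⟶ karOf (X ⊗ Y) :=
  karHom (P := karOf X ⊗ karOf Y) (monomial (M := matOf X ⊗ matOf Y) (N := matOf (X ⊗ Y))
    (fun _ => PUnit.unit) (fun _ => 𝟙 (X ⊗ Y))) (karOf_tensor_comm X Y _)

variable (C) in
/-- The unit morphism of the embedding into the additive Karoubi completion. -/
def karOfUnit : 𝟙_ (Karoubi (Mat_ C)) ⟶ karOf (𝟙_ C) :=
  karHom (P := 𝟙_ (Karoubi (Mat_ C))) (monomial (M := 𝟙_ (Mat_ C)) (N := matOf (𝟙_ C))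
    (fun _ => PUnit.unit) (fun _ => 𝟙 (𝟙_ C))) (karOf_unit_comm _)

end Tensor

variable {D : Type u'} [Category.{v'} D] [Preadditive D] (F : C ⥤ D) [F.Additive]

theorem mapKar_karOf_comm (X : C) (f : (mapMat F).obj (matOf X) ⟶ matOf (F.obj X)) :
    ((mapKar (mapMat F)).obj (karOf X)).p ≫ f = f ≫ (karOf (F.obj X)).p := by
  change (mapMat F).map (𝟙 (matOf X)) ≫ f = f ≫ 𝟙 _
  exact (congrArg (· ≫ f) ((mapMat F).map_id (matOf X))).trans
    ((Category.id_comp f).trans (Category.comp_id f).symm)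

/-- The functor induced between additive Karoubi completions extends the given functor. -/
def mapKarIso (X : C) : (mapKar (mapMat F)).obj (karOf X) ≅ karOf (F.obj X) :=
  karIso (P := (mapKar (mapMat F)).obj (karOf X)) (Q := karOf (F.obj X))
    (reindexIso (M := (mapMat F).obj (matOf X)) (N := matOf (F.obj X))
      (fun i => i) (fun i => i) (fun _ => 𝟙 (F.obj X)) (fun _ => 𝟙 (F.obj X))
      (monomial_eq_id _ fun _ => Category.comp_id _)
      (monomial_eq_id _ fun _ => Category.comp_id _))
    (mapKar_karOf_comm F X _)

theorem mapKarIso_hom (X : C) : (mapKarIso F X).hom =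
    karHom (P := (mapKar (mapMat F)).obj (karOf X)) (Q := karOf (F.obj X))
      (monomial (M := (mapMat F).obj (matOf X)) (N := matOf (F.obj X))
        (fun i => i) (fun _ => 𝟙 (F.obj X)))
      (mapKar_karOf_comm F X _) := rfl

theorem mapKar_karOfHom {X Y : C} (f : X ⟶ Y) :
    (mapKar (mapMat F)).map (karOfHom f) ≫ (mapKarIso F Y).hom =
      (mapKarIso F X).hom ≫ karOfHom (F.map f) := by
  rw [karOfHom, karOfHom, mapKar_karHom, mapKarIso_hom, mapKarIso_hom, karHom_comp, karHom_comp]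
  refine karHom_congr ?_
  rw [mapMat_monomial, monomial_comp_monomial, monomial_comp_monomial]
  exact congrArg _ (funext fun i => (Category.comp_id _).trans (Category.id_comp _).symm)

variable [MonoidalCategory C] [MonoidalPreadditive C] [MonoidalCategory D] [MonoidalPreadditive D]
  [F.Monoidal]

/-- The tensorator of the extended functor is compatible with the one of the given functor: up to
the identifications `mapKarIso` and `karOfTensor`, it is the inverse of `δ F X Y`. -/
theorem mapKar_karOfTensor (X Y : C) :
    Functor.LaxMonoidal.μ (mapKar (mapMat F)) (karOf X) (karOf Y) ≫
        (mapKar (mapMat F)).map (karOfTensor X Y) ≫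
        (mapKarIso F (X ⊗ Y)).hom ≫ karOfHom (Functor.OplaxMonoidal.δ F X Y) =
      ((mapKarIso F X).hom ⊗ₘ (mapKarIso F Y).hom) ≫ karOfTensor (F.obj X) (F.obj Y) := by
  -- the equality of the only entries of the matrices on the two sides
  have e : Functor.LaxMonoidal.μ F X Y ≫ F.map (𝟙 (X ⊗ Y)) ≫
      𝟙 _ ≫ Functor.OplaxMonoidal.δ F X Y = (𝟙 _ ⊗ₘ 𝟙 _) ≫ 𝟙 _ := by
    rw [F.map_id, Category.id_comp, Category.id_comp, Functor.Monoidal.μ_δ,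
      id_tensorHom_id, Category.id_comp]
  change (mapKarμ (mapMat F) (karOf X) (karOf Y)).hom ≫ _ = _
  rw [karOfTensor, karOfTensor, karOfHom, mapKar_karHom, mapKarIso_hom, mapKarIso_hom,
    mapKarIso_hom, karHom_tensor, mapKarμ_hom, karHom_comp, karHom_comp, karHom_comp, karHom_comp]
  refine karHom_congr ?_
  rw [mapMat_monomial]
  change monomial _ _ ≫ _ ≫ _ ≫ _ = _
  rw [monomial_tensor, monomial_comp_monomial, monomial_comp_monomial, monomial_comp_monomial,
    monomial_comp_monomial]
  exact congrArg _ (funext fun _ => e)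

theorem mapKar_karOfUnit :
    Functor.LaxMonoidal.ε (mapKar (mapMat F)) ≫ (mapKar (mapMat F)).map (karOfUnit C) ≫
        (mapKarIso F (𝟙_ C)).hom ≫ karOfHom (Functor.OplaxMonoidal.η F) = karOfUnit D := by
  have e : Functor.LaxMonoidal.ε F ≫ F.map (𝟙 (𝟙_ C)) ≫
      𝟙 _ ≫ Functor.OplaxMonoidal.η F = 𝟙 _ := by
    rw [F.map_id, Category.id_comp, Category.id_comp, Functor.Monoidal.ε_η]
  change (mapKarε (mapMat F)).hom ≫ _ = _
  rw [karOfUnit, karOfUnit, karOfHom, mapKar_karHom, mapKarIso_hom,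
    mapKarε_hom, karHom_comp, karHom_comp, karHom_comp]
  refine karHom_congr ?_
  rw [mapMat_monomial]
  change monomial _ _ ≫ _ ≫ _ ≫ _ = _
  rw [monomial_comp_monomial, monomial_comp_monomial, monomial_comp_monomial]
  exact congrArg _ (funext fun _ => e)

end Completion

section Induced

variable {A : Type u} [Category.{v} A] [RegularCat A] {K : Type w} [Field K]
  {A' : Type u'} [Category.{v'} A'] [RegularCat A'] {F : A ⥤ A'} [PreservesFiniteLimits F]
  {δ : DegreeFunction A K} {δ' : DegreeFunction A' K}

/-- A functor that preserves finite limits and degrees induces a `K`-linear symmetric monoidal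
functor between Deligne–Knop categories. -/
def inducedFunctor (h : PreservesDegree F δ δ') : InducedFunctor F δ δ' where
  functor := mapKar (mapMat (T0.map h))
  additive := inferInstance
  linear := inferInstance
  braided := inferInstance
  objIso x := mapKarIso (T0.map h) ⟨x⟩
  map_basisHom {x y} r := by
    have e : karOfHom ((T0.map h).map (T0.rel δ r)) = basisHom δ' (mapRel F r) :=
      (congrArg karOfHom (pushRel_single F r 1)).trans (karOfHom_eq _).symm
    have e' : basisHom δ r = karOfHom (T0.rel δ r) := karOfHom_eq _
    exact (congrArg (fun k => (mapKar (mapMat (T0.map h))).map k ≫ _) e').trans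
      ((mapKar_karOfHom (T0.map h) (T0.rel δ r)).trans (congrArg (fun k => _ ≫ k) e))
  tensor_comp x y :=
    (congrArg (fun k => _ ≫ _ ≫ _ ≫ k) (karOfHom_eq _)).trans
      (mapKar_karOfTensor (T0.map h) ⟨x⟩ ⟨y⟩)
  unit_comp :=
    (congrArg (fun k => _ ≫ _ ≫ _ ≫ k) (karOfHom_eq _)).trans (mapKar_karOfUnit (T0.map h))

end Induced

/-! ### Natural isomorphisms on the additive Karoubi completion -/

section Extension

open Idempotents

variable {C : Type u} [Category.{v} C] [Preadditive C]

variable (C) in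
/-- The embedding of a preadditive category into its additive Karoubi completion. -/
abbrev karEmb : C ⥤ Karoubi (Mat_ C) := Mat_.embedding C ⋙ toKaroubi (Mat_ C)

/-- The `i`-th coordinate of the inclusion of `Q` into the formal direct sum `Q.X`. -/
def toSummand (Q : Karoubi (Mat_ C)) (i : Q.X.ι) : Q ⟶ (karEmb C).obj (Q.X.X i) where
  f := fun j _ => Q.p j i
  comm := by
    refine (congrArg (fun k => Q.p ≫ k) (Category.comp_id (Y := matOf (Q.X.X i)) _)).trans ?_
    funext j _
    exact congrFun (congrFun Q.idem j) i

/-- The `i`-th component of the projection of the formal direct sum `Q.X` onto `Q`. -/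
def fromSummand (Q : Karoubi (Mat_ C)) (i : Q.X.ι) : (karEmb C).obj (Q.X.X i) ⟶ Q where
  f := fun _ j => Q.p i j
  comm := by
    refine (Category.id_comp (X := matOf (Q.X.X i)) _).trans ?_
    funext _ j
    exact congrFun (congrFun Q.idem i) j

theorem mat_sum_apply {M N : Mat_ C} {σ : Type*} (s : Finset σ) (f : σ → (M ⟶ N)) (i : M.ι)
    (j : N.ι) : (∑ k ∈ s, f k) i j = ∑ k ∈ s, f k i j :=
  map_sum ({ toFun := fun f => f i j, map_zero' := rfl, map_add' := fun _ _ => rfl } :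
    (M ⟶ N) →+ (M.X i ⟶ N.X j)) f s

theorem sum_toSummand_fromSummand (Q : Karoubi (Mat_ C)) :
    ∑ i, toSummand Q i ≫ fromSummand Q i = 𝟙 Q := by
  apply Karoubi.hom_ext
  rw [Karoubi.sum_hom]
  funext j k
  refine (mat_sum_apply _ _ j k).trans (Eq.trans (Finset.sum_congr rfl fun i _ => ?_)
    ((Mat_.comp_apply Q.p Q.p j k).symm.trans (congrFun (congrFun Q.idem j) k)))
  exact (Mat_.comp_apply (N := matOf (Q.X.X i)) _ _ j k).trans (Fintype.sum_unique _)

variable {E : Type u'} [Category.{v'} E] {F G : Karoubi (Mat_ C) ⥤ E}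

/-- A transformation between the restrictions of `F` and `G` to `C` commutes with all morphisms
between objects of `C`, as the embedding of `C` into its completion is full. -/
theorem karEmb_naturality (α : karEmb C ⋙ F ⟶ karEmb C ⋙ G) {X Y : C}
    (f : (karEmb C).obj X ⟶ (karEmb C).obj Y) :
    F.map f ≫ α.app Y = α.app X ≫ G.map f := by
  obtain ⟨f, rfl⟩ := (karEmb C).map_surjective f
  exact α.naturality f

variable [Preadditive E] [F.Additive]

theorem app_eq_sum (α : F ⟶ G) (Q : Karoubi (Mat_ C)) :
    α.app Q = ∑ i, F.map (toSummand Q i) ≫ α.app _ ≫ G.map (fromSummand Q i) := by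
  rw [← Category.id_comp (α.app Q), ← F.map_id, ← sum_toSummand_fromSummand, F.map_sum,
    Preadditive.sum_comp]
  refine Finset.sum_congr rfl fun i _ => ?_
  rw [F.map_comp, Category.assoc, α.naturality]

/-- A natural transformation between additive functors on the completion is determined by its
restriction to the original category. -/
theorem natTrans_ext_karEmb {α β : F ⟶ G}
    (h : ∀ X, α.app ((karEmb C).obj X) = β.app ((karEmb C).obj X)) : α = β := by
  ext Q
  rw [app_eq_sum, app_eq_sum β]
  exact Finset.sum_congr rfl fun i _ => by rw [h]

variable [G.Additive]

/-- The extension to the completion of a natural transformation defined on the original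
category. -/
def extendNatTrans (α : karEmb C ⋙ F ⟶ karEmb C ⋙ G) : F ⟶ G where
  app Q := ∑ i, F.map (toSummand Q i) ≫ α.app (Q.X.X i) ≫ G.map (fromSummand Q i)
  naturality P Q f := by
    -- Insert the decompositions of `𝟙 P` and `𝟙 Q`; then `α` only has to commute with the entries
    -- `fromSummand P i ≫ f ≫ toSummand Q j` of `f`.
    have h₁ : f = ∑ i, toSummand P i ≫ fromSummand P i ≫ f := by
      simp only [← Category.assoc]
      rw [← Preadditive.sum_comp, sum_toSummand_fromSummand, Category.id_comp]
    have h₂ : f = ∑ j, (f ≫ toSummand Q j) ≫ fromSummand Q j := by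
      simp only [Category.assoc]
      rw [← Preadditive.comp_sum, sum_toSummand_fromSummand, Category.comp_id]
    calc F.map f ≫ ∑ j, F.map (toSummand Q j) ≫ α.app (Q.X.X j) ≫ G.map (fromSummand Q j)
        = ∑ j, ∑ i, F.map (toSummand P i) ≫ F.map (fromSummand P i ≫ f ≫ toSummand Q j) ≫
            α.app (Q.X.X j) ≫ G.map (fromSummand Q j) := by
          rw [Preadditive.comp_sum]
          refine Finset.sum_congr rfl fun j _ => ?_
          conv_lhs => rw [h₁, F.map_sum, Preadditive.sum_comp]
          simp
      _ = ∑ i, ∑ j, F.map (toSummand P i) ≫ F.map (fromSummand P i ≫ f ≫ toSummand Q j) ≫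
            α.app (Q.X.X j) ≫ G.map (fromSummand Q j) := Finset.sum_comm
      _ = (∑ i, F.map (toSummand P i) ≫ α.app (P.X.X i) ≫ G.map (fromSummand P i)) ≫ G.map f := by
          rw [Preadditive.sum_comp]
          refine Finset.sum_congr rfl fun i _ => ?_
          conv_rhs => rw [h₂, G.map_sum, Preadditive.comp_sum]
          refine Finset.sum_congr rfl fun j _ => ?_
          rw [reassoc_of% karEmb_naturality α]
          simp

/-- The extension restricts to the given transformation, by naturality with respect to the
endomorphisms `toSummand` and `fromSummand` of an object of `C`. -/
theorem extendNatTrans_app (α : karEmb C ⋙ F ⟶ karEmb C ⋙ G) (X : C) :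
    (extendNatTrans α).app ((karEmb C).obj X) = α.app X := by
  have key {Q : Karoubi (Mat_ C)} {σ : Type} [Fintype σ] (a : F.obj Q ⟶ G.obj Q)
      (ha : ∀ f : Q ⟶ Q, F.map f ≫ a = a ≫ G.map f) (p q : σ → (Q ⟶ Q))
      (hpq : ∑ i, p i ≫ q i = 𝟙 Q) : ∑ i, F.map (p i) ≫ a ≫ G.map (q i) = a := by
    simp only [← ha, ← F.map_comp_assoc]
    rw [← Preadditive.sum_comp, ← F.map_sum, hpq, F.map_id, Category.id_comp]
  exact key (Q := (karEmb C).obj X) (α.app X) (fun f => karEmb_naturality α f)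
    (toSummand ((karEmb C).obj X)) (fromSummand ((karEmb C).obj X)) (sum_toSummand_fromSummand _)

/-- The extension to the completion of a natural isomorphism defined on the original category. -/
def extendNatIso (α : karEmb C ⋙ F ≅ karEmb C ⋙ G) : F ≅ G where
  hom := extendNatTrans α.hom
  inv := extendNatTrans α.inv
  hom_inv_id := natTrans_ext_karEmb fun X => by
    rw [NatTrans.comp_app, extendNatTrans_app, extendNatTrans_app]
    exact α.hom_inv_id_app X
  inv_hom_id := natTrans_ext_karEmb fun X => by
    rw [NatTrans.comp_app, extendNatTrans_app, extendNatTrans_app]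
    exact α.inv_hom_id_app X

end Extension

section UnitIso

variable {A : Type u} [Category.{v} A] [RegularCat A] {K : Type w} [Field K]
  {A' : Type u'} [Category.{v'} A'] [RegularCat A'] {T : A ⥤ A'} {S : A' ⥤ A}
  [PreservesFiniteLimits T] [PreservesFiniteLimits S]
  {δ : DegreeFunction A K} {δ' : DegreeFunction A' K}

/-- The graph of an isomorphism `η : 𝟭 ≅ S T` intertwines `⟨r⟩` and `⟨S T r⟩`: both composites are
the image of the span `x ⟵ r ⟶ y ⟶ S T y`, the second one after transport along `r ≅ S T r`. -/
theorem rel_comp_graph_unit (hS : PreservesDegree S δ' δ) (η : 𝟭 A ≅ T ⋙ S) {x y : A}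
    (r : Rel x y) :
    T0.rel δ r ≫ (T0.Γ δ).map (η.hom.app y) =
      (T0.Γ δ).map (η.hom.app x) ≫ T0.rel δ (mapRel S (mapRel T r)) := by
  have h : (Finsupp.single (mapRel S (mapRel T r)) 1 : LRel K _ _) =
      spanRel δ (S.map (T.map r.p)) (S.map (T.map r.q)) := by
    rw [← pushRel_span hS, ← single_mapRel T δ', pushRel_single]
  change comp δ _ _ _ (Finsupp.single r 1) (graph K (η.hom.app y)) =
    comp δ _ _ _ (graph K (η.hom.app x)) (Finsupp.single _ 1)
  rw [h, iso_comp_span, ← spanRel_rel δ r, span_comp_graph, ← spanRel_iso δ (η.hom.app (r : A))]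
  congr 1
  · rw [← Category.assoc, IsIso.eq_comp_inv]
    exact η.hom.naturality r.p
  · exact η.hom.naturality r.q

theorem basisHom_comp_unit (hS : PreservesDegree S δ' δ) (η : 𝟭 A ≅ T ⋙ S) {x y : A}
    (r : Rel x y) :
    basisHom δ r ≫ (Γ δ).map (η.hom.app y) =
      (Γ δ).map (η.hom.app x) ≫ basisHom δ (mapRel S (mapRel T r)) :=
  ((ι δ).map_comp _ _).symm.trans
    ((congrArg (ι δ).map (rel_comp_graph_unit hS η r)).trans ((ι δ).map_comp _ _))

/-- If `T` and `S` induce functors and `S T` is isomorphic to the identity by `η`, then the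
composite of the induced functors is isomorphic to the identity by `Γ η`. -/
theorem InducedFunctor.exists_iso (hS : PreservesDegree S δ' δ) (η : 𝟭 A ≅ T ⋙ S)
    (Tbar : InducedFunctor T δ δ') (Sbar : InducedFunctor S δ' δ) :
    ∃ α : 𝟭 (Del δ) ≅ Tbar.functor ⋙ Sbar.functor, ∀ x : A,
      α.hom.app (brk δ x) ≫ Sbar.functor.map (Tbar.objIso x).hom ≫ (Sbar.objIso (T.obj x)).hom =
        (Γ δ).map (η.hom.app x) := by
  have := Tbar.additive
  have := Sbar.additive
  have := Tbar.linear
  have := Sbar.linear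
  let g (x : A) : brk δ x ≅ brk δ (S.obj (T.obj x)) := (Γ δ).mapIso (η.app x)
  have hg {x y : A} (r : Rel x y) : basisHom δ r ≫ (g y).hom =
      (g x).hom ≫ basisHom δ (mapRel S (mapRel T r)) := basisHom_comp_unit hS η r
  let k (x : A) : (Tbar.functor ⋙ Sbar.functor).obj (brk δ x) ≅ brk δ (S.obj (T.obj x)) :=
    Sbar.functor.mapIso (Tbar.objIso x) ≪≫ Sbar.objIso (T.obj x)
  have hk {x y : A} (r : Rel x y) : (Tbar.functor ⋙ Sbar.functor).map (basisHom δ r) ≫ (k y).hom =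
      (k x).hom ≫ basisHom δ (mapRel S (mapRel T r)) := by
    simp only [k, Iso.trans_hom, Functor.mapIso_hom, Functor.comp_map, Category.assoc]
    rw [← Sbar.map_basisHom, ← Sbar.functor.map_comp_assoc, Tbar.map_basisHom,
      Sbar.functor.map_comp_assoc]
  -- the component at `[x]` that the claim forces
  let e (x : A) : brk δ x ≅ (Tbar.functor ⋙ Sbar.functor).obj (brk δ x) := g x ≪≫ (k x).symm
  have he (x : A) : (e x).hom ≫ (k x).hom = (g x).hom := by simp [e]
  have nat {x y : A} (r : Rel x y) : basisHom δ r ≫ (e y).hom =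
      (e x).hom ≫ (Tbar.functor ⋙ Sbar.functor).map (basisHom δ r) := by
    rw [← cancel_mono (k y).hom, Category.assoc, Category.assoc, he, hg, hk, ← he x,
      Category.assoc]
  have nat' (X Y : T0 δ) (f : LRel K X.obj Y.obj) : (ι δ).map (X := X) (Y := Y) f ≫ (e Y.obj).hom =
      (e X.obj).hom ≫ (Tbar.functor ⋙ Sbar.functor).map ((ι δ).map (X := X) (Y := Y) f) := by
    -- Both sides are linear in `f`, so that it suffices to consider the basis.
    let L₁ : LRel K X.obj Y.obj →ₗ[K]
        (brk δ X.obj ⟶ (Tbar.functor ⋙ Sbar.functor).obj (brk δ Y.obj)) :=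
      { toFun f := (ι δ).map (X := X) (Y := Y) f ≫ (e Y.obj).hom
        map_add' f g := Preadditive.add_comp _ _ _ ((ι δ).map (X := X) (Y := Y) f)
          ((ι δ).map (X := X) (Y := Y) g) _
        map_smul' c f := Linear.smul_comp _ _ _ c ((ι δ).map (X := X) (Y := Y) f) _ }
    let L₂ : LRel K X.obj Y.obj →ₗ[K]
        (brk δ X.obj ⟶ (Tbar.functor ⋙ Sbar.functor).obj (brk δ Y.obj)) :=
      { toFun f := (e X.obj).hom ≫ (Tbar.functor ⋙ Sbar.functor).map ((ι δ).map (X := X) (Y := Y) f)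
        map_add' f g := (congrArg _ ((Tbar.functor ⋙ Sbar.functor).map_add
          (f := (ι δ).map (X := X) (Y := Y) f) (g := (ι δ).map (X := X) (Y := Y) g))).trans
          (Preadditive.comp_add _ _ _ _ _ _)
        map_smul' c f := (congrArg _ ((Tbar.functor ⋙ Sbar.functor).map_smul c
          ((ι δ).map (X := X) (Y := Y) f))).trans (Linear.comp_smul _ _ _ _ _ _) }
    exact LinearMap.congr_fun (Finsupp.lhom_ext' fun r => LinearMap.ext_ring (nat r) : L₁ = L₂) f
  let α₀ : karEmb (T0 δ) ⋙ 𝟭 _ ≅ karEmb (T0 δ) ⋙ Tbar.functor ⋙ Sbar.functor :=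
    NatIso.ofComponents (fun X => e X.obj) fun {X Y} f => nat' X Y f
  refine ⟨extendNatIso α₀, fun x => ?_⟩
  refine Eq.trans ?_ (he x)
  exact congrArg (· ≫ (k x).hom) (extendNatTrans_app α₀.hom ⟨x⟩)

end UnitIso

/-! ### Trivial actions and orbits -/

section FiniteSets

variable (G : Type w) [Group G]

/-- The trivial action functor preserves colimits, as these are computed on underlying sets. -/
instance : PreservesFiniteColimits (triv.{u} G) where
  preservesFiniteColimits J _ _ := by
    have : PreservesColimitsOfShape J (triv.{u} G ⋙ Action.forget FintypeCat.{u} G) :=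
      inferInstanceAs (PreservesColimitsOfShape J (𝟭 FintypeCat.{u}))
    exact Action.preservesColimitsOfShape_of_preserves (triv.{u} G) this

instance : PreservesFiniteColimits (orb.{u} G) :=
  have := (orbTriv.{u} G).leftAdjoint_preservesColimits
  inferInstance

instance : PreservesFiniteLimits (trivOp.{u} G) := preservesFiniteLimits_op _

instance : PreservesFiniteLimits (orbOp.{u} G) := preservesFiniteLimits_op _

/-- Every equivariant map between trivial actions is just a map. -/
def trivFullyFaithful : (triv.{u} G).FullyFaithful where
  preimage f := f.hom

instance : (triv.{u} G).Full := (trivFullyFaithful G).full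

instance : (triv.{u} G).Faithful := (trivFullyFaithful G).faithful

variable {G} {K : Type v} [Field K]

theorem finprod_mem_const_eq_pow {α : Type*} {s : Set α} (hs : s.Finite) (t : K) :
    ∏ᶠ _a ∈ s, t = t ^ s.ncard := by
  rw [finprod_mem_eq_finite_toFinset_prod _ hs, Finset.prod_const, Set.ncard_eq_toFinset_card s hs]

/-- A trivial `G`-set is its own set of orbits, so that the orbits outside the image of `f` are the
points outside it. -/
theorem ncard_orbitsOutside_triv {X Y : FintypeCat.{u}} (f : X ⟶ Y) :
    (orbitsOutside ((triv G).map f)).ncard = (Set.range f)ᶜ.ncard := by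
  have hinj : Function.Injective (orbitMk ((triv G).obj Y)) := by
    intro a b hab
    obtain ⟨g, hg⟩ := orbitMk_eq.1 hab
    exact hg.symm
  have h : orbitsOutside ((triv G).map f) = orbitMk ((triv G).obj Y) '' (Set.range f)ᶜ := by
    ext ω
    obtain ⟨y, rfl⟩ := orbitMk_surj ω
    rw [mem_orbitsOutside, hinj.mem_set_image]
    rfl
  rw [h, Set.ncard_image_of_injective _ hinj]
  rfl

theorem compl_range_orbitMap {X Y : Action FintypeCat.{u} G} (f : X ⟶ Y) :
    (Set.range (orbitMap f))ᶜ = orbitsOutside f := by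
  ext ω
  obtain ⟨y, rfl⟩ := orbitMk_surj ω
  rw [mem_orbitsOutside, Set.mem_compl_iff, Set.mem_compl_iff, not_iff_not]
  constructor
  · rintro ⟨ω, hω⟩
    obtain ⟨x, rfl⟩ := orbitMk_surj ω
    obtain ⟨g, hg⟩ := orbitMk_eq.1 hω.symm
    exact ⟨g • x, (hom_smul f g x).trans hg⟩
  · rintro ⟨x, rfl⟩
    exact ⟨orbitMk X x, rfl⟩

theorem orbitMap_injective {X Y : Action FintypeCat.{u} G} {f : X ⟶ Y}
    (hf : Function.Injective f.hom) : Function.Injective (orbitMap f) := by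
  intro ω ω' e
  obtain ⟨x, rfl⟩ := orbitMk_surj ω
  obtain ⟨x', rfl⟩ := orbitMk_surj ω'
  obtain ⟨g, hg⟩ := orbitMk_eq.1 e
  exact orbitMk_eq.2 ⟨g, hf ((hom_smul f g x').trans hg)⟩

theorem trivOp_preservesDegree (t : K) :
    PreservesDegree (trivOp.{u} G) (degSets t) (degGSets fun _ => t) := by
  intro x y e _
  have he : Function.Injective e.unop := (mono_iff_injective _).1 inferInstance
  have : Mono ((triv G).map e.unop) := (mono_iff_injective_hom _).2 he
  refine ⟨inferInstanceAs (Epi ((triv G).map e.unop).op), ?_⟩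
  refine (finprod_mem_const_eq_pow (Set.toFinite _) t).trans ?_
  exact congrArg (t ^ ·) (ncard_orbitsOutside_triv e.unop)

theorem orbOp_preservesDegree (t : K) :
    PreservesDegree (orbOp.{u} G) (degGSets fun _ => t) (degSets t) := by
  intro x y e _
  have he : Function.Injective e.unop.hom := (mono_iff_injective_hom _).1 inferInstance
  have : Mono ((orb G).map e.unop) := (mono_iff_injective _).2 (orbitMap_injective he)
  refine ⟨inferInstanceAs (Epi ((orb G).map e.unop).op), ?_⟩
  refine Eq.trans ?_ (finprod_mem_const_eq_pow (Set.toFinite _) t).symm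
  exact congrArg (fun s : Set _ => t ^ s.ncard) (compl_range_orbitMap e.unop)

end FiniteSets

end Knop

end

theorem mainTheorem8 {K : Type v} [Field K] {G : Type w} [Group G] [Finite G] (t : K) :
    PreservesLimitsOfShape WalkingCospan (Knop.trivOp.{u} G) ∧
    PreservesLimitsOfShape WalkingCospan (Knop.orbOp.{u} G) ∧
    PreservesLimitsOfShape (Discrete PEmpty.{1}) (Knop.trivOp.{u} G) ∧
    PreservesLimitsOfShape (Discrete PEmpty.{1}) (Knop.orbOp.{u} G) ∧
    Knop.PreservesDegree (Knop.trivOp.{u} G) (Knop.degSets t) (Knop.degGSets fun _ => t) ∧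
    Knop.PreservesDegree (Knop.orbOp.{u} G) (Knop.degGSets fun _ => t) (Knop.degSets t) ∧
    Nonempty (Knop.InducedFunctor (Knop.trivOp.{u} G)
      (Knop.degSets t) (Knop.degGSets fun _ => t)) ∧
    Nonempty (Knop.InducedFunctor (Knop.orbOp.{u} G)
      (Knop.degGSets fun _ => t) (Knop.degSets t)) ∧
    ∀ (Tbar : Knop.InducedFunctor (Knop.trivOp.{u} G)
        (Knop.degSets t) (Knop.degGSets fun _ => t))
      (Fbar : Knop.InducedFunctor (Knop.orbOp.{u} G)
        (Knop.degGSets fun _ => t) (Knop.degSets t)),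
      ∃ α : 𝟭 (Knop.Del (Knop.degSets t)) ≅ Tbar.functor ⋙ Fbar.functor,
        ∀ x : FintypeCat.{u}ᵒᵖ,
          α.hom.app (Knop.brk (Knop.degSets t) x) ≫ Fbar.functor.map (Tbar.objIso x).hom ≫
              (Fbar.objIso ((Knop.trivOp G).obj x)).hom =
            (Knop.Γ (Knop.degSets t)).map ((Knop.adjTrivOrb G).unit.app x) := by
  refine ⟨inferInstance, inferInstance, inferInstance, inferInstance,
    Knop.trivOp_preservesDegree t, Knop.orbOp_preservesDegree t,
    ⟨Knop.inducedFunctor (Knop.trivOp_preservesDegree t)⟩,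
    ⟨Knop.inducedFunctor (Knop.orbOp_preservesDegree t)⟩, fun Tbar Fbar => ?_⟩
  exact Knop.InducedFunctor.exists_iso (Knop.orbOp_preservesDegree t)
    (asIso (Knop.adjTrivOrb G).unit) Tbar Fbar
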